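/- Let $G$ be a discrete group. All rings are associative, not necessarily unital, carry a $G$-action by ring automorphisms, and are quadratik (every element is a finite sum of products). A right functional $B$-module $(\mathcal E,S)$ over a $G$-ring $(B,\beta)$ is a right $B$-module with a $G$-action $S$ by additive maps, $S_g(\xi b)=S_g(\xi)\beta_g(b)$, and a $G$-invariant left $B$-submodule $\Theta_B(\mathcal E)\subseteq \mathrm{Hom}_B(\mathcal E,B)$ of functionals. $\mathcal K_B(\mathcal E)$ is the ring of finite sums of the operators $\theta_{\eta,\phi}(\xi)=\eta\,\phi(\xi)$ ($\eta\in\mathcal E$, $\phi\in\Theta_B(\mathcal E)$), with the action $\mathrm{Ad}(S)$. $\mathcal E$ is cofull if every element is a finite sum of elements $\xi\phi(\eta)$, and separated by functionals if $\phi(\xi)=0$ for all $\phi\in\Theta_B(\mathcal E)$ implies $\xi=0$. A ring $B$ is a functional module over itself with the left multiplications by elements of $B$ as functionals. In direct sums $\bigoplus_i\mathcal E_i$ (finite support) the functionals are $\bigoplus_i\phi_i$ for arbitrary families $\phi_i\in\Theta_B(\mathcal E_i)$. The internal tensor product $\mathcal E\otimes_\pi\mathcal F$ is $\mathcal E\otimes_{\mathbb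 Z}\mathcal F$ modulo all $\sum\xi_i\otimes\eta_i$ with $\sum\pi(\phi(\xi_i))\eta_i=0$ for every $\phi\in\Theta(\mathcal E)$; its functionals are the finite sums of $\xi\otimes\eta\mapsto\psi(\pi(\phi(\xi))\eta)$. The crossed product $B\rtimes_\beta G$ consists of the finite formal sums $\sum_g b_g\rtimes g$ with $(a\rtimes g)(b\rtimes h)=a\beta_g(b)\rtimes gh$; $B$ acts on it from the left through $b\mapsto b\rtimes 1$, and $V_g(b\rtimes h):=\beta_g(b)\rtimes gh$. Let $\mathbb H_B=\bigoplus_{i\in I}B$ with a $G$-action of the form $\beta\oplus T$ with respect to $B\oplus\bigoplus_{i\ne i_0}B$. If $\mathcal E\oplus\mathbb H_B$ is cofull, the ring homomorphism $e:B\to\mathcal K_B(\mathcal E\oplus\mathbb H_B)$ letting $e(b)$ act as left multiplication by $b$ on the coordinate $i_0$ and as zero on all other summands is called a corner embedding; so is its composition with an equivariant ring isomorphism of the target. $GK^G$ is the additive category whose objects are the $G$-equivariant quadratik rings and whose morphisms are generated under composition, addition and subtraction by the equivariant ring homomorphisms, a formal inverse $e^{-1}$ for every corner embedding $e$, and a morphism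 $\Delta_{\mathcal S}:M\to B$ for every equivariant split exact sequence $\mathcal S:0\to B\xrightarrow{j}M\xrightarrow{f}A\to0$ with split $s$. The relations (compositions being written from left to right) are: composition and identities of ring homomorphisms; $1_{A\oplus B}=p_Ai_A+p_Bi_B$; $f_0=f_1$ for homotopic homomorphisms, where $f_0,f_1:A\to B$ are homotopic if there is an equivariant ring homomorphism $f:A\to B\otimes_{\mathbb Z} C([0,1],\mathbb C)$ whose evaluations at $0$ and $1$ are $a\mapsto f_0(a)\otimes1$ and $a\mapsto f_1(a)\otimes 1$ in $B\otimes_{\mathbb Z}\mathbb C$; $ee^{-1}=1$, $e^{-1}e=1$; $j\Delta_{\mathcal S}=1_B$, $\Delta_{\mathcal S}j+fs=1_M$. $GK$ is this category for the trivial group. **Proposition.** Let $(\mathcal E,S)$ be a cofull functional $(B,\beta)$-module. Then $\mathcal E\otimes_B(B\rtimes_\beta G)$ is cofull, and the formula $$\sigma(T\rtimes g)=(T\otimes1)\circ(S_g\otimes V_g)$$ defines a surjective ring homomorphism $$\sigma:\mathcal K_B(\mathcal E)\rtimes_{\mathrm{Ad}(S)}G\to\mathcal K_{B\rtimes_\beta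 G}\big(\mathcal E\otimes_B(B\rtimes_\beta G)\big),$$ whose kernel consists of all $\sum_gT_g\rtimes g$ with $\phi\circ T_g=0$ for all $g\in G$, $\phi\in\Theta_B(\mathcal E)$. In particular, $\sigma$ is a ring isomorphism if $\mathcal E$ is separated by functionals. **Corollary.** (i) Let $e:B\to\mathcal K_B(\mathcal E\oplus\mathbb H_B)$ be a corner embedding as above, where the cofull module $\mathcal E\oplus\mathbb H_B$ is separated by functionals. Put $R:=B\rtimes_\beta G$. Let $X:(\mathcal E\oplus\mathbb H_B)\otimes_BR\to(\mathcal E\otimes_BR)\oplus\mathbb H_R$ be the canonical additive bijection $(\xi\oplus(b_i)_i)\otimes x\mapsto(\xi\otimes x)\oplus(b_ix)_i$, where $\mathbb H_R=\bigoplus_{i\in I}R$. Then $(\mathcal E\otimes_BR)\oplus\mathbb H_R$ is cofull, $\pi(T)=XTX^{-1}$ defines an injective ring homomorphism $$\pi:\mathcal K_R\big((\mathcal E\oplus\mathbb H_B)\otimes_BR\big)\to\mathcal K_R\big((\mathcal E\otimes_BR)\oplus\mathbb H_R\big),$$ which is an isomorphism if $I$ is finite, $\sigma$ is an isomorphism for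 the module $\mathcal E\oplus\mathbb H_B$, and $\pi\circ\sigma\circ(e\rtimes1)$ is the corner embedding $R\to\mathcal K_R((\mathcal E\otimes_BR)\oplus\mathbb H_R)$ at the coordinate $i_0$; the latter is injective if $e$ is. (ii) For every equivariant corner embedding $e:A\to K$ (any $I$, separated or not), $e\rtimes1:A\rtimes G\to K\rtimes G$, $a\rtimes g\mapsto e(a)\rtimes g$, is a corner embedding up to isomorphism. **Descent functor.** There is exactly one additive functor $j^G:GK^G\to GK$ with $j^G(A)=A\rtimes G$ on objects, $j^G(\pi)=\pi\rtimes1$ for equivariant ring homomorphisms $\pi$, $j^G(e^{-1})=(j^G(e))^{-1}$ for corner embeddings $e$ (in particular $j^G(e)$ is invertible), and $j^G(\Delta_{\mathcal S})=\Delta_{\mathcal S\rtimes G}$ for split exact sequences $\mathcal S$, where $\mathcal S\rtimes G$ is the split exact sequence of crossed products. -/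

import Mathlib

open CategoryTheory TensorProduct

universe u

namespace GKT

noncomputable section

/-! ### Quadratik rings with an action of a discrete group -/

/-- A (not necessarily unital) ring is quadratik if every element is a finite sum of products. -/
def IsQuadratik (A : Type u) [NonUnitalRing A] : Prop :=
  ∀ a : A, a ∈ AddSubgroup.closure {z : A | ∃ b c : A, z = b * c}

/-- Objects of the category of `G`-equivariant quadratik rings. -/
structure QRing (G : Type u) [Group G] where
  carrier : Type u
  [ring : NonUnitalRing carrier]
  action : G →* RingAut carrier
  quadratik : IsQuadratik carrier

attribute [instance] QRing.ring

instance (G : Type u) [Group G] : CoeSort (QRing G) (Type u) := ⟨QRing.carrier⟩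

/-- `G`-equivariant ring homomorphisms. -/
@[ext]
structure EHom {G : Type u} [Group G] (A B : QRing G) where
  toHom : A →ₙ+* B
  equivariant : ∀ (g : G) (a : A), toHom (A.action g a) = B.action g (toHom a)

namespace EHom

variable {G : Type u} [Group G]

def id (A : QRing G) : EHom A A := ⟨NonUnitalRingHom.id A, fun _ _ => rfl⟩

/-- Composition in the order "first `f`, then `h`". -/
def comp {A B C : QRing G} (f : EHom A B) (h : EHom B C) : EHom A C :=
  ⟨h.toHom.comp f.toHom, fun g a => by
    simp [f.equivariant, h.equivariant]⟩

end EHom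

/-! ### Functional modules and compact operators -/

/-- A right functional module over a ring `A`: a right `A`-module together with a distinguished
left `A`-submodule `functionals` of the module homomorphisms from it to `A`. -/
structure FModule (A : Type u) [NonUnitalRing A] where
  carrier : Type u
  [addCommGroup : AddCommGroup carrier]
  act : carrier →+ A →+ carrier
  act_mul : ∀ ξ a b, act ξ (a * b) = act (act ξ a) b
  functionals : AddSubgroup (carrier →+ A)
  functionals_act : ∀ φ ∈ functionals, ∀ ξ a, φ (act ξ a) = φ ξ * a
  functionals_smul : ∀ (a : A), ∀ φ ∈ functionals, (AddMonoidHom.mulLeft a).comp φ ∈ functionals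

attribute [instance] FModule.addCommGroup

instance (A : Type u) [NonUnitalRing A] : CoeSort (FModule A) (Type u) := ⟨FModule.carrier⟩

namespace FModule

variable {A : Type u} [NonUnitalRing A]

/-- Every element is a finite sum of elements `ξ φ(η)`. -/
def Cofull (E : FModule A) : Prop :=
  ∀ ζ : E, ζ ∈ AddSubgroup.closure
    {z : E | ∃ (ξ η : E), ∃ φ ∈ E.functionals, z = E.act ξ (φ η)}

/-- The functionals separate the points. -/
def Separated (E : FModule A) : Prop :=
  ∀ ξ : E, (∀ φ ∈ E.functionals, φ ξ = 0) → ξ = 0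

/-- The elementary operator `θ_{η,φ} : ξ ↦ η φ(ξ)`. -/
def theta (E : FModule A) (η : E) (φ : E →+ A) : AddMonoid.End E := (E.act η).comp φ

@[simp] theorem theta_apply (E : FModule A) (η : E) (φ : E →+ A) (ξ : E) :
    E.theta η φ ξ = E.act η (φ ξ) := rfl

/-- The ring of compact operators: finite sums of elementary operators. -/
def compacts (E : FModule A) : NonUnitalSubring (AddMonoid.End E) where
  __ := AddSubgroup.closure {T : AddMonoid.End E | ∃ η : E, ∃ φ ∈ E.functionals, T = E.theta η φ}
  mul_mem' := by
    intro a b ha hb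
    change a ∈ AddSubgroup.closure _ at ha
    change b ∈ AddSubgroup.closure _ at hb
    change a * b ∈ AddSubgroup.closure _
    induction ha using AddSubgroup.closure_induction with
    | zero => simp
    | add x y _ _ hx hy => rw [add_mul]; exact add_mem hx hy
    | neg x _ hx => rw [neg_mul]; exact neg_mem hx
    | mem x hx =>
      obtain ⟨η, φ, hφ, rfl⟩ := hx
      induction hb using AddSubgroup.closure_induction with
      | zero => simp
      | add x y _ _ hx hy => rw [mul_add]; exact add_mem hx hy
      | neg x _ hx => rw [mul_neg]; exact neg_mem hx
      | mem x hx =>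
        obtain ⟨ζ, ψ, hψ, rfl⟩ := hx
        refine AddSubgroup.subset_closure ⟨E.act η (φ ζ), ψ, hψ, ?_⟩
        ext ξ
        simp [E.functionals_act φ hφ, E.act_mul]

theorem mem_compacts {E : FModule A} {T : AddMonoid.End E} : T ∈ E.compacts ↔
    T ∈ AddSubgroup.closure {T : AddMonoid.End E | ∃ η : E, ∃ φ ∈ E.functionals, T = E.theta η φ} :=
  Iff.rfl

/-- The ring of adjointable operators: module homomorphisms `T` with `φ ∘ T` a distinguished
functional for every distinguished functional `φ`. -/
def adjointable (E : FModule A) : Subring (AddMonoid.End E) where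
  carrier := {T | (∀ ξ a, T (E.act ξ a) = E.act (T ξ) a) ∧
    ∀ φ ∈ E.functionals, AddMonoidHom.comp φ T ∈ E.functionals}
  mul_mem' := by
    rintro S T ⟨hS, hS'⟩ ⟨hT, hT'⟩
    exact ⟨fun ξ a => by simp [hS, hT], fun φ hφ => hT' _ (hS' φ hφ)⟩
  one_mem' := ⟨fun _ _ => rfl, fun _ h => h⟩
  add_mem' := by
    rintro S T ⟨hS, hS'⟩ ⟨hT, hT'⟩
    refine ⟨fun ξ a => ?_, fun φ hφ => ?_⟩
    · change S _ + T _ = E.act (S ξ + T ξ) a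
      rw [hS, hT, map_add]
      rfl
    have : AddMonoidHom.comp φ (S + T) = AddMonoidHom.comp φ S + AddMonoidHom.comp φ T :=
      AddMonoidHom.ext fun ξ => map_add φ _ _
    rw [this]
    exact add_mem (hS' φ hφ) (hT' φ hφ)
  zero_mem' := by
    refine ⟨fun _ _ => by simp, fun φ _ => ?_⟩
    have : AddMonoidHom.comp φ (0 : AddMonoid.End E) = 0 :=
      AddMonoidHom.ext fun ξ => map_zero φ
    rw [this]
    exact zero_mem _
  neg_mem' := by
    rintro S ⟨hS, hS'⟩
    refine ⟨fun ξ a => ?_, fun φ hφ => ?_⟩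
    · change -S _ = E.act (-S ξ) a
      rw [hS, map_neg]
      rfl
    have : AddMonoidHom.comp φ (-S) = -AddMonoidHom.comp φ S :=
      AddMonoidHom.ext fun ξ => map_neg φ _
    rw [this]
    exact neg_mem (hS' φ hφ)

/-- The ring `A` as a right functional module over itself; the functionals are the left
multiplications by elements of `A`. -/
def self (A : Type u) [NonUnitalRing A] : FModule A where
  carrier := A
  act := AddMonoidHom.mul
  act_mul ξ a b := (mul_assoc ξ a b).symm
  functionals := (AddMonoidHom.mul : A →+ A →+ A).range
  functionals_act := by
    rintro _ ⟨c, rfl⟩ ξ a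
    exact (mul_assoc c ξ a).symm
  functionals_smul := by
    rintro a _ ⟨c, rfl⟩
    exact ⟨a * c, by ext ξ; exact mul_assoc a c ξ⟩

/-- The direct sum of two functional modules, with functionals `φ ⊕ ψ`. -/
def prod (E F : FModule A) : FModule A where
  carrier := E × F
  act := AddMonoidHom.mk' (fun ξ => (E.act ξ.1).prod (F.act ξ.2)) (by
    intro ξ η; ext <;> simp)
  act_mul ξ a b := by simp [E.act_mul, F.act_mul]
  functionals :=
    { carrier := {χ | ∃ φ ∈ E.functionals, ∃ ψ ∈ F.functionals, χ = φ.coprod ψ}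
      add_mem' := by
        rintro _ _ ⟨φ, hφ, ψ, hψ, rfl⟩ ⟨φ', hφ', ψ', hψ', rfl⟩
        refine ⟨φ + φ', add_mem hφ hφ', ψ + ψ', add_mem hψ hψ', ?_⟩
        ext ξ
        exact add_add_add_comm _ _ _ _
      zero_mem' := ⟨0, zero_mem _, 0, zero_mem _, by ext <;> simp⟩
      neg_mem' := by
        rintro _ ⟨φ, hφ, ψ, hψ, rfl⟩
        refine ⟨-φ, neg_mem hφ, -ψ, neg_mem hψ, ?_⟩
        ext ξ
        exact neg_add _ _ }
  functionals_act := by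
    rintro _ ⟨φ, hφ, ψ, hψ, rfl⟩ ξ a
    simp [E.functionals_act φ hφ, F.functionals_act ψ hψ, add_mul]
  functionals_smul := by
    rintro a _ ⟨φ, hφ, ψ, hψ, rfl⟩
    refine ⟨_, E.functionals_smul a φ hφ, _, F.functionals_smul a ψ hψ, ?_⟩
    ext ξ
    exact mul_add a _ _

/-- The functional `η ↦ ∑ i, c i * η i` on finitely supported families. -/
def rowFunctional (A : Type u) [NonUnitalRing A] (I : Type u) : (I → A) →+ ((I →₀ A) →+ A) :=
  AddMonoidHom.mk' (fun c => Finsupp.liftAddHom fun i => AddMonoidHom.mulLeft (c i)) (by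
    intro c d; ext i a; simp [add_mul])

/-- The direct sum `⨁_{i ∈ I} A` of copies of the functional module `A`: finitely supported
families, with functionals `⨁ φ_i` for arbitrary families of functionals `φ_i` on `A`. -/
def copies (A : Type u) [NonUnitalRing A] (I : Type u) : FModule A where
  carrier := I →₀ A
  act := AddMonoidHom.flip (AddMonoidHom.mk'
    (fun a => Finsupp.mapRange.addMonoidHom (AddMonoidHom.mulRight a)) (by
      intro a b; ext i x j; simp [mul_add]))
  act_mul ξ a b := by ext i; simp [mul_assoc]
  functionals := (rowFunctional A I).range
  functionals_act := by
    rintro _ ⟨c, rfl⟩ ξ a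
    induction ξ using Finsupp.induction_linear with
    | zero => simp
    | add x y hx hy => simp only [map_add, AddMonoidHom.add_apply, hx, hy, add_mul]
    | single i x =>
      have h : (Finsupp.mapRange.addMonoidHom (AddMonoidHom.mulRight a) (Finsupp.single i x) :
          I →₀ A) = Finsupp.single i (x * a) := by simp
      change rowFunctional A I c (Finsupp.mapRange.addMonoidHom (AddMonoidHom.mulRight a)
        (Finsupp.single i x)) = rowFunctional A I c (Finsupp.single i x) * a
      rw [h]
      simp only [rowFunctional, AddMonoidHom.mk'_apply, Finsupp.liftAddHom_apply_single,
        AddMonoidHom.coe_mulLeft, mul_assoc]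
  functionals_smul := by
    rintro a _ ⟨c, rfl⟩
    exact ⟨fun i => a * c i, by ext i x; simp [rowFunctional, mul_assoc]⟩

/-- The coordinate `i` of an element of `⨁_{i ∈ I} A`. -/
def coord {I : Type u} (i : I) : copies A I →+ A := Finsupp.applyAddHom (M := A) i

/-- The inclusion of the summand with index `i` of `⨁_{i ∈ I} A`. -/
def single {I : Type u} (i : I) : A →+ copies A I := Finsupp.singleAddHom (M := A) i

theorem copies_ext {I : Type u} {ξ η : copies A I} (h : ∀ i, coord i ξ = coord i η) : ξ = η :=
  Finsupp.ext h

@[simp] theorem coord_act {I : Type u} (η : copies A I) (a : A) (i : I) :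
    coord i ((copies A I).act η a) = coord i η * a := rfl

@[simp] theorem coord_single_same {I : Type u} (i : I) (a : A) : coord i (single i a) = a :=
  Finsupp.single_eq_same

theorem coord_single_of_ne {I : Type u} {i k : I} (h : k ≠ i) (a : A) :
    coord k (single i a) = 0 := Finsupp.single_eq_of_ne h

/-! ### The internal tensor product -/

section tensor

variable {B : Type u} [NonUnitalRing B] (E : FModule A) (F : FModule B)
  (π : A →ₙ+* F.adjointable)

/-- The map `E ⊗ F → F`, `ξ ⊗ η ↦ π(φ(ξ)) η`. -/
def tensorEval (φ : E →+ A) : (E ⊗[ℤ] F) →+ F :=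
  TensorProduct.liftAddHom
    (AddMonoidHom.comp (F.adjointable.subtype.toAddMonoidHom.comp π.toAddMonoidHom) φ :
      E →+ F →+ F)
    (by
      intro r ξ η
      simp only [map_zsmul]
      rfl)

@[simp] theorem tensorEval_tmul (φ : E →+ A) (ξ : E) (η : F) :
    tensorEval E F π φ (ξ ⊗ₜ η) = (π (φ ξ) : AddMonoid.End F) η := rfl

/-- The subgroup of all `∑ ξᵢ ⊗ ηᵢ` such that `∑ π(φ(ξᵢ)) ηᵢ = 0` for all functionals `φ`. -/
def tensorNull : AddSubgroup (E ⊗[ℤ] F) where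
  carrier := {t | ∀ φ ∈ E.functionals, tensorEval E F π φ t = 0}
  add_mem' := fun hs ht φ hφ => by rw [map_add, hs φ hφ, ht φ hφ, add_zero]
  zero_mem' := fun φ _ => map_zero _
  neg_mem' := fun ht φ hφ => by rw [map_neg, ht φ hφ, neg_zero]

/-- Right multiplication by `b` on `E ⊗ F`. -/
def tensorRight (b : B) : (E ⊗[ℤ] F) →+ (E ⊗[ℤ] F) :=
  (TensorProduct.map (LinearMap.id : E →ₗ[ℤ] E)
    (AddMonoidHom.toIntLinearMap (F.act.flip b))).toAddMonoidHom

@[simp] theorem tensorRight_tmul (b : B) (ξ : E) (η : F) :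
    tensorRight E F b (ξ ⊗ₜ η) = ξ ⊗ₜ F.act η b := rfl

theorem tensorEval_right (φ : E →+ A) (b : B) (t : E ⊗[ℤ] F) :
    tensorEval E F π φ (tensorRight E F b t) = F.act (tensorEval E F π φ t) b := by
  induction t using TensorProduct.induction_on with
  | zero => simp
  | add x y hx hy => simp only [map_add, hx, hy, AddMonoidHom.add_apply]
  | tmul ξ η => simpa using (π (φ ξ)).2.1 η b

/-- The right multiplication on the internal tensor product. -/
def tensorAct : ((E ⊗[ℤ] F) ⧸ tensorNull E F π) →+ B →+ ((E ⊗[ℤ] F) ⧸ tensorNull E F π) :=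
  AddMonoidHom.flip (AddMonoidHom.mk'
    (fun b => QuotientAddGroup.map (tensorNull E F π) (tensorNull E F π) (tensorRight E F b) (by
      intro t ht φ hφ
      rw [tensorEval_right, ht φ hφ]; simp)) (by
    intro a b
    ext t
    induction t using TensorProduct.induction_on with
    | zero => simp
    | add x y hx hy => simp only [map_add, hx, hy]
    | tmul ξ η =>
      change ((ξ ⊗ₜ[ℤ] F.act η (a + b) : E ⊗[ℤ] F) : (E ⊗[ℤ] F) ⧸ tensorNull E F π)
        = ((ξ ⊗ₜ[ℤ] F.act η a : E ⊗[ℤ] F) : (E ⊗[ℤ] F) ⧸ tensorNull E F π)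
          + ((ξ ⊗ₜ[ℤ] F.act η b : E ⊗[ℤ] F) : (E ⊗[ℤ] F) ⧸ tensorNull E F π)
      rw [map_add, TensorProduct.tmul_add]; rfl))

theorem tensorAct_mk (t : E ⊗[ℤ] F) (b : B) :
    tensorAct E F π (QuotientAddGroup.mk t) b = QuotientAddGroup.mk (tensorRight E F b t) := rfl

/-- The functional `φ ⊗ ψ`, `ξ ⊗ η ↦ ψ(π(φ(ξ)) η)`. -/
def tensorFunctional (φ : E.functionals) (ψ : F →+ B) :
    ((E ⊗[ℤ] F) ⧸ tensorNull E F π) →+ B :=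
  QuotientAddGroup.lift (tensorNull E F π) (ψ.comp (tensorEval E F π φ)) (by
    intro t ht
    simp [ht φ.1 φ.2])

theorem tensorFunctional_mk (φ : E.functionals) (ψ : F →+ B) (t : E ⊗[ℤ] F) :
    tensorFunctional E F π φ ψ (QuotientAddGroup.mk t) = ψ (tensorEval E F π φ t) := rfl

/-- The internal tensor product `E ⊗_π F`, a right functional `B`-module, whose functionals are the
finite sums of functionals `φ ⊗ ψ`. -/
def tensor : FModule B where
  carrier := (E ⊗[ℤ] F) ⧸ tensorNull E F π
  act := tensorAct E F π
  act_mul := by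
    intro ξ a b
    obtain ⟨t, rfl⟩ := QuotientAddGroup.mk_surjective ξ
    simp only [tensorAct_mk]
    congr 1
    induction t using TensorProduct.induction_on with
    | zero => simp
    | add x y hx hy => simp only [map_add, hx, hy]
    | tmul ξ η => simp [F.act_mul]
  functionals := AddSubgroup.closure
    {χ | ∃ (φ : E.functionals) (ψ : F.functionals), χ = tensorFunctional E F π φ ψ}
  functionals_act := by
    intro χ hχ ξ a
    obtain ⟨t, rfl⟩ := QuotientAddGroup.mk_surjective ξ
    induction hχ using AddSubgroup.closure_induction with
    | zero => simp
    | add x y _ _ hx hy => simp only [AddMonoidHom.add_apply, hx, hy, add_mul]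
    | neg x _ hx => simp only [AddMonoidHom.neg_apply, hx, neg_mul]
    | mem x hx =>
      obtain ⟨φ, ψ, rfl⟩ := hx
      rw [tensorAct_mk, tensorFunctional_mk, tensorFunctional_mk, tensorEval_right,
        F.functionals_act _ ψ.2]
  functionals_smul := by
    intro a χ hχ
    induction hχ using AddSubgroup.closure_induction with
    | zero =>
      rw [AddMonoidHom.comp_zero]; exact zero_mem _
    | add x y _ _ hx hy => rw [AddMonoidHom.comp_add]; exact add_mem hx hy
    | neg x _ hx =>
      have : (AddMonoidHom.mulLeft a).comp (-x) = -(AddMonoidHom.mulLeft a).comp x := by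
        ext; simp
      rw [this]; exact neg_mem hx
    | mem x hx =>
      obtain ⟨φ, ψ, rfl⟩ := hx
      refine AddSubgroup.subset_closure ⟨φ, ⟨_, F.functionals_smul a ψ ψ.2⟩, ?_⟩
      ext t
      rfl

/-- The class of `ξ ⊗ η` in the internal tensor product. -/
def tmk (ξ : E) (η : F) : tensor E F π :=
  (QuotientAddGroup.mk (ξ ⊗ₜ[ℤ] η) : (E ⊗[ℤ] F) ⧸ tensorNull E F π)

end tensor

end FModule

/-! ### Group actions on functional modules -/

/-- A `G`-action on a functional module over a `G`-ring, leaving the functionals invariant. -/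
structure ModAction {G : Type u} [Group G] {A : Type u} [NonUnitalRing A] (α : G →* RingAut A)
    (E : FModule A) where
  S : G →* AddMonoid.End E
  S_act : ∀ g ξ a, S g (E.act ξ a) = E.act (S g ξ) (α g a)
  invariant : ∀ (g : G), ∀ φ ∈ E.functionals,
    ((α g : A ≃+ A).toAddMonoidHom.comp φ).comp (S g⁻¹) ∈ E.functionals

namespace ModAction

variable {G : Type u} [Group G] {A : Type u} [NonUnitalRing A] {α : G →* RingAut A}
  {E F : FModule A}

theorem S_inv_apply (S : ModAction α E) (g : G) (ξ : E) : S.S g⁻¹ (S.S g ξ) = ξ := by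
  have h : S.S g⁻¹ * S.S g = 1 := by rw [← map_mul]; simp
  exact DFunLike.congr_fun h ξ

theorem S_apply_inv (S : ModAction α E) (g : G) (ξ : E) : S.S g (S.S g⁻¹ ξ) = ξ := by
  have h : S.S g * S.S g⁻¹ = 1 := by rw [← map_mul]; simp
  exact DFunLike.congr_fun h ξ

theorem conj_mem (S : ModAction α E) (g : G) {T : AddMonoid.End E} (hT : T ∈ E.compacts) :
    S.S g * T * S.S g⁻¹ ∈ E.compacts := by
  rw [FModule.mem_compacts] at hT
  induction hT using AddSubgroup.closure_induction with
  | zero => simp [zero_mem]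
  | add x y _ _ hx hy => rw [mul_add, add_mul]; exact add_mem hx hy
  | neg x _ hx => rw [mul_neg, neg_mul]; exact neg_mem hx
  | mem x hx =>
    obtain ⟨η, φ, hφ, rfl⟩ := hx
    refine AddSubgroup.subset_closure ⟨S.S g η, _, S.invariant g φ hφ, ?_⟩
    refine AddMonoidHom.ext fun ξ => ?_
    exact S.S_act g η _

/-- The action `Ad(S)` on the compact operators, `(g, T) ↦ S_g ∘ T ∘ S_{g⁻¹}`. -/
def Ad (S : ModAction α E) : G →* RingAut E.compacts where
  toFun g :=
    { toFun := fun T => ⟨S.S g * T * S.S g⁻¹, S.conj_mem g T.2⟩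
      invFun := fun T => ⟨S.S g⁻¹ * T * S.S g, by simpa using S.conj_mem g⁻¹ T.2⟩
      left_inv := fun T => by ext ξ; simp [S_inv_apply]
      right_inv := fun T => by ext ξ; simp [S_apply_inv]
      map_mul' := fun T U => by ext ξ; simp [S_inv_apply]
      map_add' := fun T U => by
        refine Subtype.ext ?_
        change S.S g * ((T : AddMonoid.End E) + U) * S.S g⁻¹ =
          S.S g * (T : AddMonoid.End E) * S.S g⁻¹ + S.S g * (U : AddMonoid.End E) * S.S g⁻¹
        rw [mul_add, add_mul] }
  map_one' := by ext T ξ; simp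
  map_mul' g h := by ext T ξ; simp

/-- The diagonal action on a direct sum. -/
def prod (S : ModAction α E) (T : ModAction α F) : ModAction α (E.prod F) where
  S :=
    { toFun := fun g => AddMonoidHom.prodMap (S.S g) (T.S g)
      map_one' := by
        refine AddMonoidHom.ext fun ξ => ?_
        change (S.S 1 ξ.1, T.S 1 ξ.2) = ξ
        simp
      map_mul' := fun g h => by
        refine AddMonoidHom.ext fun ξ => ?_
        change (S.S (g * h) ξ.1, T.S (g * h) ξ.2) = (S.S g (S.S h ξ.1), T.S g (T.S h ξ.2))
        simp }
  S_act g ξ a := Prod.ext (S.S_act g ξ.1 a) (T.S_act g ξ.2 a)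
  invariant := by
    rintro g _ ⟨φ, hφ, ψ, hψ, rfl⟩
    refine ⟨_, S.invariant g φ hφ, _, T.invariant g ψ hψ, ?_⟩
    refine AddMonoidHom.ext fun ξ => ?_
    exact map_add (α g) _ _

/-- The action on `⨁_{i ∈ I} A` is of the form `α ⊕ T` with respect to the decomposition
`A ⊕ ⨁_{i ≠ i₀} A`; the coordinate `i₀` is then the distinguished one. -/
def IsDistinguished {I : Type u} (U : ModAction α (FModule.copies A I)) (i₀ : I) : Prop :=
  (∀ g (a : A), U.S g (FModule.single i₀ a) = FModule.single i₀ (α g a)) ∧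
  ∀ g (η : FModule.copies A I), FModule.coord i₀ η = 0 → FModule.coord i₀ (U.S g η) = 0

theorem IsDistinguished.coord_S {I : Type u} {U : ModAction α (FModule.copies A I)} {i₀ : I}
    (hU : U.IsDistinguished i₀) (g : G) (η : FModule.copies A I) :
    FModule.coord i₀ (U.S g η) = α g (FModule.coord i₀ η) := by
  have h := hU.2 g (η - FModule.single i₀ (FModule.coord i₀ η)) (by simp)
  rw [map_sub, hU.1, map_sub, FModule.coord_single_same, sub_eq_zero] at h
  exact h

end ModAction

/-! ### Corner embeddings -/

section corner

variable {A : Type u} [NonUnitalRing A]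

/-- The operator `ξ ⊕ η ↦ 0 ⊕ a η_{i₀}` (in the coordinate `i₀`) on `E ⊕ ⨁_{i ∈ I} A`. -/
def cornerOp (E : FModule A) (I : Type u) (i₀ : I) (a : A) :
    AddMonoid.End (E.prod (FModule.copies A I)) :=
  AddMonoidHom.comp (AddMonoidHom.inr E (FModule.copies A I))
    ((FModule.single i₀).comp ((AddMonoidHom.mulLeft a).comp
      ((FModule.coord i₀).comp (AddMonoidHom.snd E (FModule.copies A I)))))

theorem cornerOp_add (E : FModule A) (I : Type u) (i₀ : I) (a b : A) :
    cornerOp E I i₀ (a + b) = cornerOp E I i₀ a + cornerOp E I i₀ b := by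
  refine AddMonoidHom.ext fun x => ?_
  refine Prod.ext (add_zero (0 : E)).symm ?_
  change FModule.single i₀ ((a + b) * FModule.coord i₀ x.2)
    = FModule.single i₀ (a * FModule.coord i₀ x.2) + FModule.single i₀ (b * FModule.coord i₀ x.2)
  rw [add_mul, map_add]

theorem rowFunctional_single {I : Type u} [DecidableEq I] (i₀ : I) (c : A)
    (η : FModule.copies A I) :
    FModule.rowFunctional A I (Pi.single i₀ c) η = c * FModule.coord i₀ η := by
  refine Finsupp.induction_linear (motive := fun η : FModule.copies A I =>
    FModule.rowFunctional A I (Pi.single i₀ c) η = c * FModule.coord i₀ η) η ?_ ?_ ?_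
  · exact (map_zero _).trans (by rw [show FModule.coord i₀ (0 : I →₀ A) = (0 : A) from rfl, mul_zero])
  · intro x y hx hy
    rw [show FModule.coord i₀ (x + y) = FModule.coord i₀ x + FModule.coord i₀ y from rfl, mul_add,
      ← hx, ← hy]
    exact map_add _ _ _
  · intro i x
    change FModule.rowFunctional A I (Pi.single i₀ c) (Finsupp.single i x) =
      c * FModule.coord i₀ (FModule.single i x)
    by_cases h : i = i₀
    · subst h; simp [FModule.rowFunctional]
    · rw [FModule.coord_single_of_ne (Ne.symm h)]; simp [FModule.rowFunctional, h]

theorem cornerOp_mem (hA : IsQuadratik A) (E : FModule A) (I : Type u) (i₀ : I) (a : A) :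
    cornerOp E I i₀ a ∈ (E.prod (FModule.copies A I)).compacts := by
  classical
  let f : A →+ AddMonoid.End (E.prod (FModule.copies A I)) :=
    AddMonoidHom.mk' (cornerOp E I i₀) (cornerOp_add E I i₀)
  change f a ∈ _
  have ha := hA a
  induction ha using AddSubgroup.closure_induction with
  | zero => rw [map_zero]; exact zero_mem _
  | add x y _ _ hx hy => rw [map_add]; exact add_mem hx hy
  | neg x _ hx => rw [map_neg]; exact neg_mem hx
  | mem x hx =>
    obtain ⟨b, c, rfl⟩ := hx
    refine AddSubgroup.subset_closure ⟨((0, FModule.single i₀ b) : E × FModule.copies A I),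
      (0 : E →+ A).coprod (FModule.rowFunctional A I (Pi.single i₀ c)),
      ⟨0, zero_mem _, _, ⟨_, rfl⟩, rfl⟩, ?_⟩
    refine AddMonoidHom.ext fun x => Prod.ext ?_ (FModule.copies_ext fun i => ?_)
    · exact (DFunLike.congr_fun (map_zero E.act) _).symm
    · change FModule.coord i (FModule.single i₀ (b * c * FModule.coord i₀ x.2)) =
        FModule.coord i (FModule.single i₀ b) *
          ((0 : E →+ A) x.1 + FModule.rowFunctional A I (Pi.single i₀ c) x.2)
      rw [rowFunctional_single]
      by_cases h : i = i₀
      · subst h; simp [mul_assoc]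
      · simp [FModule.coord_single_of_ne h]

/-- The corner homomorphism `A → K_A(E ⊕ ⨁_{i ∈ I} A)`, acting by multiplication on the
coordinate `i₀`. -/
def cornerHom (hA : IsQuadratik A) (E : FModule A) (I : Type u) (i₀ : I) :
    A →ₙ+* (E.prod (FModule.copies A I)).compacts where
  toFun a := ⟨cornerOp E I i₀ a, cornerOp_mem hA E I i₀ a⟩
  map_mul' a b := by
    refine Subtype.ext (AddMonoidHom.ext fun x => Prod.ext rfl ?_)
    change FModule.single i₀ (a * b * FModule.coord i₀ x.2)
      = FModule.single i₀ (a * FModule.coord i₀ (FModule.single i₀ (b * FModule.coord i₀ x.2)))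
    simp [mul_assoc]
  map_zero' := by
    refine Subtype.ext (AddMonoidHom.ext fun x => Prod.ext rfl ?_)
    change FModule.single i₀ (0 * FModule.coord i₀ x.2) = 0
    simp
  map_add' a b := Subtype.ext (cornerOp_add E I i₀ a b)

theorem cornerHom_equivariant {G : Type u} [Group G] {α : G →* RingAut A} (hA : IsQuadratik A)
    {E : FModule A} (S : ModAction α E) {I : Type u} {i₀ : I}
    (U : ModAction α (FModule.copies A I)) (hU : U.IsDistinguished i₀) (g : G) (a : A) :
    cornerHom hA E I i₀ (α g a) = (S.prod U).Ad g (cornerHom hA E I i₀ a) := by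
  refine Subtype.ext (AddMonoidHom.ext fun x => Prod.ext (map_zero (S.S g)).symm ?_)
  change FModule.single i₀ (α g a * FModule.coord i₀ x.2)
    = U.S g (FModule.single i₀ (a * FModule.coord i₀ (U.S g⁻¹ x.2)))
  have h : α g (α g⁻¹ (FModule.coord i₀ x.2)) = FModule.coord i₀ x.2 := by
    rw [← RingAut.mul_apply, ← map_mul]; simp
  rw [hU.1, hU.coord_S, map_mul (α g), h]

end corner

/-- An equivariant homomorphism `e : A → K` is a corner embedding if, up to an equivariant ring
isomorphism `K ≅ K_A(E ⊕ H_A)`, it is the multiplication on the distinguished coordinate of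
`H_A = ⨁_{i ∈ I} A`, where `E ⊕ H_A` is cofull. -/
def IsCorner {G : Type u} [Group G] {A K : QRing G} (e : EHom A K) : Prop :=
  ∃ (E : FModule A) (S : ModAction A.action E) (I : Type u) (i₀ : I)
    (U : ModAction A.action (FModule.copies A I)) (_ : U.IsDistinguished i₀)
    (_ : (E.prod (FModule.copies A I)).Cofull)
    (κ : K ≃+* (E.prod (FModule.copies A I)).compacts),
    (∀ g x, κ (K.action g x) = (S.prod U).Ad g (κ x)) ∧
    ∀ a, κ (e.toHom a) = cornerHom A.quadratik E I i₀ a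

/-! ### Crossed products -/

section crossed

variable {G : Type u} [Group G] {A : Type u} [NonUnitalRing A]

/-- The crossed product `A ⋊_α G`: finitely supported functions `G → A`;
`Crossed.mk α a g` is the element `a ⋊ g`. -/
def Crossed (_α : G →* RingAut A) : Type u := G →₀ A

namespace Crossed

variable (α : G →* RingAut A)

instance : AddCommGroup (Crossed α) := inferInstanceAs (AddCommGroup (G →₀ A))

/-- The element `a ⋊ g`. -/
def mk (a : A) (g : G) : Crossed α := (Finsupp.single g a : G →₀ A)

/-- The coefficient at `g`. -/
def coeff {α : G →* RingAut A} (x : Crossed α) (g : G) : A := (show G →₀ A from x) g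

/-- The additive map out of the crossed product with given values on the `a ⋊ g`. -/
def lift {M : Type u} [AddCommGroup M] (f : G → A →+ M) : Crossed α →+ M :=
  Finsupp.liftAddHom (M := A) (N := M) f

@[simp] theorem lift_mk {M : Type u} [AddCommGroup M] (f : G → A →+ M) (a : A) (g : G) :
    lift α f (mk α a g) = f g a := Finsupp.liftAddHom_apply_single _ _ _

def mkHom (g : G) : A →+ Crossed α := Finsupp.singleAddHom g

@[simp] theorem mkHom_apply (a : A) (g : G) : mkHom α g a = mk α a g := rfl

theorem induction {α : G →* RingAut A} {p : Crossed α → Prop} (x : Crossed α) (h0 : p 0)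
    (hadd : ∀ x y, p x → p y → p (x + y)) (hmk : ∀ a g, p (mk α a g)) : p x :=
  Finsupp.induction_linear (motive := p) x h0 hadd (fun g a => hmk a g)

/-- Convolution: `(a ⋊ g) (b ⋊ h) = a α_g(b) ⋊ g h`. -/
def mulHom : Crossed α →+ Crossed α →+ Crossed α :=
  lift α fun g => AddMonoidHom.mk' (fun a => lift α fun h =>
    (mkHom α (g * h)).comp ((AddMonoidHom.mulLeft a).comp (α g : A ≃+ A).toAddMonoidHom)) (by
      intro a b
      refine AddMonoidHom.ext fun x => ?_
      induction x using induction with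
      | h0 => simp
      | hadd x y hx hy => rw [map_add, hx, hy, map_add]
      | hmk c h =>
        simp only [AddMonoidHom.add_apply, lift_mk, AddMonoidHom.comp_apply,
          AddMonoidHom.coe_mulLeft, add_mul, map_add])

instance : Mul (Crossed α) := ⟨fun x y => mulHom α x y⟩

theorem mul_def (x y : Crossed α) : x * y = mulHom α x y := rfl

theorem mk_mul_mk (a b : A) (g h : G) :
    mk α a g * mk α b h = mk α (a * α g b) (g * h) := by
  rw [mul_def, mulHom, lift_mk]
  simp

instance : NonUnitalRing (Crossed α) where
  left_distrib x y z := by simp [mul_def]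
  right_distrib x y z := by simp [mul_def]
  zero_mul x := by simp [mul_def]
  mul_zero x := by simp [mul_def]
  mul_assoc x y z := by
    have hl : ∀ x y z : Crossed α, (x + y) * z = x * z + y * z := by simp [mul_def]
    have hr : ∀ x y z : Crossed α, x * (y + z) = x * y + x * z := by simp [mul_def]
    have h0 : ∀ x : Crossed α, 0 * x = 0 := by simp [mul_def]
    have h1 : ∀ x : Crossed α, x * 0 = 0 := by simp [mul_def]
    induction x using induction with
    | h0 => simp only [h0]
    | hadd x x' hx hx' => simp only [hl, hx, hx']
    | hmk a g =>
      induction y using induction with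
      | h0 => simp only [h0, h1]
      | hadd y y' hy hy' => simp only [hl, hr, hy, hy']
      | hmk b h =>
        induction z using induction with
        | h0 => simp only [h1]
        | hadd z z' hz hz' => simp only [hr, hz, hz']
        | hmk c k => simp [mk_mul_mk, mul_assoc]

theorem quadratik (hA : IsQuadratik A) : IsQuadratik (Crossed α) := by
  intro x
  induction x using induction with
  | h0 => exact zero_mem _
  | hadd x y hx hy => exact add_mem hx hy
  | hmk a g =>
    change mkHom α g a ∈ _
    have ha := hA a
    induction ha using AddSubgroup.closure_induction with
    | zero => rw [map_zero]; exact zero_mem _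
    | add x y _ _ hx hy => rw [map_add]; exact add_mem hx hy
    | neg x _ hx => rw [map_neg]; exact neg_mem hx
    | mem x hx =>
      obtain ⟨b, c, rfl⟩ := hx
      refine AddSubgroup.subset_closure ⟨mk α b g, mk α (α g⁻¹ c) 1, ?_⟩
      have h : α g (α g⁻¹ c) = c := by
        rw [← RingAut.mul_apply, ← map_mul]; simp
      rw [mk_mul_mk, h, mul_one]
      rfl

/-- The homomorphism `π ⋊ 1`, `a ⋊ g ↦ π(a) ⋊ g`, of an equivariant homomorphism `π`. -/
def map {B : Type u} [NonUnitalRing B] {α : G →* RingAut A} {β : G →* RingAut B}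
    (π : A →ₙ+* B) (hπ : ∀ g a, π (α g a) = β g (π a)) : Crossed α →ₙ+* Crossed β where
  __ := lift α fun g => (mkHom β g).comp π.toAddMonoidHom
  map_mul' x y := by
    change lift α (fun g => (mkHom β g).comp π.toAddMonoidHom) (x * y) =
      lift α (fun g => (mkHom β g).comp π.toAddMonoidHom) x *
      lift α (fun g => (mkHom β g).comp π.toAddMonoidHom) y
    induction x using induction with
    | h0 => simp
    | hadd x x' hx hx' => simp only [add_mul, map_add, hx, hx']
    | hmk a g =>
      induction y using induction with
      | h0 => simp
      | hadd y y' hy hy' => simp only [mul_add, map_add, hy, hy']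
      | hmk b h =>
        rw [mk_mul_mk, lift_mk, lift_mk, lift_mk]
        change mk β (π (a * α g b)) (g * h) = mk β (π a) g * mk β (π b) h
        rw [mk_mul_mk, map_mul, hπ]

theorem map_mk {B : Type u} [NonUnitalRing B] {α : G →* RingAut A} {β : G →* RingAut B}
    (π : A →ₙ+* B) (hπ : ∀ g a, π (α g a) = β g (π a)) (a : A) (g : G) :
    map π hπ (mk α a g) = mk β (π a) g := lift_mk _ _ _ _

theorem coeff_map {B : Type u} [NonUnitalRing B] {α : G →* RingAut A} {β : G →* RingAut B}
    (π : A →ₙ+* B) (hπ : ∀ g a, π (α g a) = β g (π a)) (x : Crossed α) (g : G) :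
    coeff (map π hπ x) g = π (coeff x g) := by
  classical
  induction x using induction with
  | h0 => rw [map_zero]; exact (map_zero π).symm
  | hadd x y hx hy =>
    rw [map_add]
    change coeff (map π hπ x) g + coeff (map π hπ y) g = π (coeff x g + coeff y g)
    rw [hx, hy, map_add]
  | hmk a h =>
    rw [map_mk]
    change (Finsupp.single h (π a) : G →₀ B) g = π ((Finsupp.single h a : G →₀ A) g)
    rw [Finsupp.single_apply, Finsupp.single_apply]
    split_ifs <;> simp

theorem ext {α : G →* RingAut A} {x y : Crossed α} (h : ∀ g, coeff x g = coeff y g) : x = y :=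
  Finsupp.ext h

theorem map_injective {B : Type u} [NonUnitalRing B] {α : G →* RingAut A} {β : G →* RingAut B}
    (π : A →ₙ+* B) (hπ : ∀ g a, π (α g a) = β g (π a)) (h : Function.Injective π) :
    Function.Injective (map π hπ) := fun x y hxy => ext fun g => h (by
  rw [← coeff_map π hπ, ← coeff_map π hπ, hxy])

theorem map_exact {B C : Type u} [NonUnitalRing B] [NonUnitalRing C] {α : G →* RingAut A}
    {β : G →* RingAut B} {γ : G →* RingAut C}
    (j : A →ₙ+* B) (hj : ∀ g a, j (α g a) = β g (j a))
    (f : B →ₙ+* C) (hf : ∀ g a, f (β g a) = γ g (f a)) (h : ∀ m, f m = 0 ↔ ∃ a, j a = m)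
    (x : Crossed β) : map f hf x = 0 ↔ ∃ y, map j hj y = x := by
  classical
  constructor
  · intro hx
    have hx' : ∀ g, ∃ a, j a = coeff x g := fun g => (h _).1 (by
      rw [← coeff_map f hf, hx]; rfl)
    choose a ha using hx'
    refine ⟨∑ g ∈ (show G →₀ B from x).support, mk α (a g) g, ?_⟩
    rw [map_sum]
    simp only [map_mk, ha]
    exact Finsupp.sum_single (show G →₀ B from x)
  · rintro ⟨y, rfl⟩
    refine ext fun g => ?_
    rw [coeff_map, coeff_map]
    exact (h _).2 ⟨_, rfl⟩

/-- The operator `V_g` on `A ⋊ G`, `V_g(b ⋊ h) = α_g(b) ⋊ g h`. -/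
def V (g : G) : Crossed α →+ Crossed α :=
  lift α fun h => (mkHom α (g * h)).comp (α g : A ≃+ A).toAddMonoidHom

theorem V_mk (g : G) (b : A) (h : G) : V α g (mk α b h) = mk α (α g b) (g * h) := lift_mk _ _ _ _

/-- The left multiplication of `A` on the functional `A ⋊ G`-module `A ⋊ G`,
`a (b ⋊ h) = a b ⋊ h`. -/
def leftMul : A →ₙ+* (FModule.self (Crossed α)).adjointable where
  toFun a := ⟨(AddMonoidHom.mulLeft (mk α a 1) : Crossed α →+ Crossed α), by
    refine ⟨fun ξ b => (mul_assoc (mk α a 1) ξ b).symm, ?_⟩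
    rintro _ ⟨c, rfl⟩
    exact ⟨c * mk α a 1, AddMonoidHom.ext fun ξ => mul_assoc c (mk α a 1) ξ⟩⟩
  map_mul' a b := by
    refine Subtype.ext (AddMonoidHom.ext fun (x : Crossed α) => ?_)
    change mk α (a * b) 1 * x = mk α a 1 * (mk α b 1 * x)
    rw [← mul_assoc, mk_mul_mk]
    simp
  map_zero' := by
    refine Subtype.ext (AddMonoidHom.ext fun (x : Crossed α) => ?_)
    change mkHom α 1 0 * x = 0
    rw [map_zero, zero_mul]
  map_add' a b := by
    refine Subtype.ext (AddMonoidHom.ext fun (x : Crossed α) => ?_)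
    change mkHom α 1 (a + b) * x = mkHom α 1 a * x + mkHom α 1 b * x
    rw [map_add, add_mul]

end Crossed

/-- The functional `A ⋊ G`-module `E ⊗_A (A ⋊ G)`. -/
def descentModule (α : G →* RingAut A) (E : FModule A) : FModule (Crossed α) :=
  FModule.tensor E (FModule.self (Crossed α)) (Crossed.leftMul α)

/-- The element `ξ ⊗ x` of `E ⊗_A (A ⋊ G)`. -/
def descentTmul (α : G →* RingAut A) (E : FModule A) (ξ : E) (x : Crossed α) :
    descentModule α E :=
  FModule.tmk E (FModule.self (Crossed α)) (Crossed.leftMul α) ξ x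

/-- `σ(T ⋊ g) = (T ⊗ 1) ∘ (S_g ⊗ V_g)`, as operators on `E ⊗_A (A ⋊ G)`. -/
def IsDescentIso {α : G →* RingAut A} {E : FModule A} (S : ModAction α E)
    (σ : Crossed S.Ad → (descentModule α E).compacts) : Prop :=
  ∀ (T : E.compacts) (g : G) (ξ : E) (x : Crossed α),
    (σ (Crossed.mk S.Ad T g) : AddMonoid.End (descentModule α E)) (descentTmul α E ξ x) =
      descentTmul α E ((T : AddMonoid.End E) (S.S g ξ)) (Crossed.V α g x)

end crossed

/-! ### Constructions with equivariant quadratik rings -/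

section rings

variable {G : Type u} [Group G]

/-- The direct sum of two equivariant rings. -/
def QRing.prod (A B : QRing G) : QRing G where
  carrier := A × B
  action :=
    { toFun := fun g => RingEquiv.prodCongr (A.action g) (B.action g)
      map_one' := by ext x <;> simp
      map_mul' := fun g h => by ext x <;> simp }
  quadratik := by
    intro x
    have h1 : ∀ a : A, ((a, 0) : A × B) ∈
        AddSubgroup.closure {z : A × B | ∃ b c : A × B, z = b * c} := by
      intro a
      change AddMonoidHom.inl A B a ∈ _
      have h := A.quadratik a
      induction h using AddSubgroup.closure_induction with
      | zero => rw [map_zero]; exact zero_mem _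
      | add x y _ _ hx hy => rw [map_add]; exact add_mem hx hy
      | neg x _ hx => rw [map_neg]; exact neg_mem hx
      | mem x hx =>
        obtain ⟨b, c, rfl⟩ := hx
        exact AddSubgroup.subset_closure ⟨(b, 0), (c, 0), by ext <;> simp⟩
    have h2 : ∀ a : B, ((0, a) : A × B) ∈
        AddSubgroup.closure {z : A × B | ∃ b c : A × B, z = b * c} := by
      intro a
      change AddMonoidHom.inr A B a ∈ _
      have h := B.quadratik a
      induction h using AddSubgroup.closure_induction with
      | zero => rw [map_zero]; exact zero_mem _
      | add x y _ _ hx hy => rw [map_add]; exact add_mem hx hy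
      | neg x _ hx => rw [map_neg]; exact neg_mem hx
      | mem x hx =>
        obtain ⟨b, c, rfl⟩ := hx
        exact AddSubgroup.subset_closure ⟨(0, b), (0, c), by ext <;> simp⟩
    have hx : x = (x.1, 0) + (0, x.2) := by ext <;> simp
    rw [hx]
    exact add_mem (h1 _) (h2 _)

def EHom.fst (A B : QRing G) : EHom (A.prod B) A := ⟨NonUnitalRingHom.fst A B, fun _ _ => rfl⟩

def EHom.snd (A B : QRing G) : EHom (A.prod B) B := ⟨NonUnitalRingHom.snd A B, fun _ _ => rfl⟩

def EHom.inl (A B : QRing G) : EHom A (A.prod B) :=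
  ⟨NonUnitalRingHom.prod (NonUnitalRingHom.id A) 0, fun g _ =>
    Prod.ext rfl (map_zero (B.action g)).symm⟩

def EHom.inr (A B : QRing G) : EHom B (A.prod B) :=
  ⟨NonUnitalRingHom.prod 0 (NonUnitalRingHom.id B), fun g _ =>
    Prod.ext (map_zero (A.action g)).symm rfl⟩

/-- Evaluation at time `t`, as a map `B ⊗ C[0,1] → B ⊗ ℂ`. -/
def evalAt (B : Type u) [NonUnitalRing B] (t : unitInterval) :
    B ⊗[ℤ] C(unitInterval, ℂ) →ₗ[ℤ] B ⊗[ℤ] ℂ :=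
  TensorProduct.map LinearMap.id
    (AddMonoidHom.toIntLinearMap ⟨⟨fun f => f t, rfl⟩, fun _ _ => rfl⟩)

/-- Two equivariant homomorphisms `f₀, f₁ : A → B` are homotopic if there is an equivariant ring
homomorphism `f : A → B ⊗ C[0,1]` (trivial action on `C[0,1] = C([0,1], ℂ)`) whose evaluations at
the end points are `a ↦ f₀(a) ⊗ 1` and `a ↦ f₁(a) ⊗ 1` in `B ⊗ ℂ`. -/
def Homotopic {A B : QRing G} (f₀ f₁ : EHom A B) : Prop :=
  ∃ f : A →ₙ+* (B ⊗[ℤ] C(unitInterval, ℂ)),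
    (∀ g a, f (A.action g a) = TensorProduct.map
      (AddMonoidHom.toIntLinearMap (B.action g : B ≃+ B).toAddMonoidHom) LinearMap.id (f a)) ∧
    (∀ a, evalAt B 0 (f a) = f₀.toHom a ⊗ₜ[ℤ] (1 : ℂ)) ∧
    ∀ a, evalAt B 1 (f a) = f₁.toHom a ⊗ₜ[ℤ] (1 : ℂ)

/-- Equivariant split exact sequences `0 → B → M → A → 0` with split `s : A → M`. -/
structure SplitExact (G : Type u) [Group G] where
  B : QRing G
  M : QRing G
  A : QRing G
  j : EHom B M
  f : EHom M A
  s : EHom A M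
  injective : Function.Injective j.toHom
  exact : ∀ m, f.toHom m = 0 ↔ ∃ b, j.toHom b = m
  split : ∀ a, f.toHom (s.toHom a) = a

end rings

/-! ### The category `GK^G` -/

/-- Words in the generating morphisms: equivariant ring homomorphisms, formal inverses of corner
embeddings, formal splits `Δ` of split exact sequences, identities, composition and addition. -/
inductive Word (G : Type u) [Group G] : QRing G → QRing G → Type (u + 1)
  | hom {A B : QRing G} (f : EHom A B) : Word G A B
  | cornerInv {A K : QRing G} (e : EHom A K) (he : IsCorner e) : Word G K A
  | delta (s : SplitExact G) : Word G s.M s.B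
  | one (A : QRing G) : Word G A A
  | comp {A B C : QRing G} (x : Word G A B) (y : Word G B C) : Word G A C
  | zero (A B : QRing G) : Word G A B
  | add {A B : QRing G} (x y : Word G A B) : Word G A B
  | neg {A B : QRing G} (x : Word G A B) : Word G A B

/-- The relations of `GK^G`. Composition is written from left to right. -/
inductive Rel {G : Type u} [Group G] : {A B : QRing G} → Word G A B → Word G A B → Prop
  -- equivalence relation and congruence
  | refl {A B : QRing G} (x : Word G A B) : Rel x x
  | symm {A B : QRing G} {x y : Word G A B} : Rel x y → Rel y x
  | trans {A B : QRing G} {x y z : Word G A B} : Rel x y → Rel y z → Rel x z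
  | comp_congr {A B C : QRing G} {x x' : Word G A B} {y y' : Word G B C} :
      Rel x x' → Rel y y' → Rel (x.comp y) (x'.comp y')
  | add_congr {A B : QRing G} {x x' y y' : Word G A B} :
      Rel x x' → Rel y y' → Rel (x.add y) (x'.add y')
  | neg_congr {A B : QRing G} {x x' : Word G A B} : Rel x x' → Rel x.neg x'.neg
  -- category with bilinear composition
  | comp_assoc {A B C D : QRing G} (x : Word G A B) (y : Word G B C) (z : Word G C D) :
      Rel ((x.comp y).comp z) (x.comp (y.comp z))
  | one_comp {A B : QRing G} (x : Word G A B) : Rel ((Word.one A).comp x) x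
  | comp_one {A B : QRing G} (x : Word G A B) : Rel (x.comp (Word.one B)) x
  | add_assoc {A B : QRing G} (x y z : Word G A B) : Rel ((x.add y).add z) (x.add (y.add z))
  | add_comm {A B : QRing G} (x y : Word G A B) : Rel (x.add y) (y.add x)
  | zero_add {A B : QRing G} (x : Word G A B) : Rel ((Word.zero A B).add x) x
  | neg_add {A B : QRing G} (x : Word G A B) : Rel (x.neg.add x) (Word.zero A B)
  | comp_add {A B C : QRing G} (x : Word G A B) (y z : Word G B C) :
      Rel (x.comp (y.add z)) ((x.comp y).add (x.comp z))
  | add_comp {A B C : QRing G} (x y : Word G A B) (z : Word G B C) :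
      Rel ((x.add y).comp z) ((x.comp z).add (y.comp z))
  -- composition of ring homomorphisms
  | hom_comp {A B C : QRing G} (f : EHom A B) (h : EHom B C) :
      Rel ((Word.hom f).comp (Word.hom h)) (Word.hom (f.comp h))
  -- unit
  | hom_id (A : QRing G) : Rel (Word.hom (EHom.id A)) (Word.one A)
  -- additive category
  | biprod (A B : QRing G) :
      Rel (Word.one (A.prod B))
        (((Word.hom (EHom.fst A B)).comp (Word.hom (EHom.inl A B))).add
          ((Word.hom (EHom.snd A B)).comp (Word.hom (EHom.inr A B))))
  -- homotopy invariance
  | homotopy {A B : QRing G} (f₀ f₁ : EHom A B) :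
      Homotopic f₀ f₁ → Rel (Word.hom f₀) (Word.hom f₁)
  -- stability
  | corner_left {A K : QRing G} (e : EHom A K) (he : IsCorner e) :
      Rel ((Word.hom e).comp (Word.cornerInv e he)) (Word.one A)
  | corner_right {A K : QRing G} (e : EHom A K) (he : IsCorner e) :
      Rel ((Word.cornerInv e he).comp (Word.hom e)) (Word.one K)
  -- split exactness
  | split_left (s : SplitExact G) :
      Rel ((Word.hom s.j).comp (Word.delta s)) (Word.one s.B)
  | split_right (s : SplitExact G) :
      Rel (((Word.delta s).comp (Word.hom s.j)).add ((Word.hom s.f).comp (Word.hom s.s)))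
        (Word.one s.M)

/-- The objects of the category `GK^G`: all `G`-equivariant quadratik rings. -/
@[ext]
structure GK (G : Type u) [Group G] where
  ring : QRing G

namespace GK

variable {G : Type u} [Group G]

instance setoid (A B : QRing G) : Setoid (Word G A B) :=
  ⟨Rel, ⟨Rel.refl, Rel.symm, Rel.trans⟩⟩

/-- Morphisms of `GK^G`: words modulo relations. -/
def Hom (A B : GK G) : Type (u + 1) := Quotient (setoid A.ring B.ring)

/-- The morphism represented by a word. -/
def cls {A B : GK G} (x : Word G A.ring B.ring) : Hom A B := Quotient.mk _ x

instance (A B : GK G) : Zero (Hom A B) := ⟨cls (Word.zero A.ring B.ring)⟩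

instance (A B : GK G) : Add (Hom A B) :=
  ⟨Quotient.map₂ Word.add (fun _ _ h _ _ h' => Rel.add_congr h h')⟩

instance (A B : GK G) : Neg (Hom A B) := ⟨Quotient.map Word.neg (fun _ _ h => Rel.neg_congr h)⟩

instance (A B : GK G) : AddCommGroup (Hom A B) where
  add_assoc := by rintro ⟨x⟩ ⟨y⟩ ⟨z⟩; exact Quotient.sound (Rel.add_assoc x y z)
  add_comm := by rintro ⟨x⟩ ⟨y⟩; exact Quotient.sound (Rel.add_comm x y)
  zero_add := by rintro ⟨x⟩; exact Quotient.sound (Rel.zero_add x)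
  add_zero := by
    rintro ⟨x⟩; exact Quotient.sound ((Rel.add_comm _ _).trans (Rel.zero_add x))
  neg_add_cancel := by rintro ⟨x⟩; exact Quotient.sound (Rel.neg_add x)
  nsmul := nsmulRec
  zsmul := zsmulRec

/-- Composition of morphisms, from left to right. -/
def comp {A B C : GK G} (x : Hom A B) (y : Hom B C) : Hom A C :=
  Quotient.map₂ Word.comp (fun _ _ h _ _ h' => Rel.comp_congr h h') x y

instance : Category.{u + 1} (GK G) where
  Hom A B := Hom A B
  id A := cls (Word.one A.ring)
  comp x y := comp x y
  id_comp := by rintro A B ⟨x⟩; exact Quotient.sound (Rel.one_comp x)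
  comp_id := by rintro A B ⟨x⟩; exact Quotient.sound (Rel.comp_one x)
  assoc := by rintro A B C D ⟨x⟩ ⟨y⟩ ⟨z⟩; exact Quotient.sound (Rel.comp_assoc x y z)

instance (A B : GK G) : AddCommGroup (A ⟶ B) := inferInstanceAs (AddCommGroup (Hom A B))

instance : Preadditive (GK G) where
  add_comp := by rintro A B C ⟨x⟩ ⟨y⟩ ⟨z⟩; exact Quotient.sound (Rel.add_comp x y z)
  comp_add := by rintro A B C ⟨x⟩ ⟨y⟩ ⟨z⟩; exact Quotient.sound (Rel.comp_add x y z)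

/-- The class of an equivariant ring homomorphism. -/
def ofHom {A B : QRing G} (f : EHom A B) : (⟨A⟩ : GK G) ⟶ ⟨B⟩ := cls (Word.hom f)

/-- The synthetical morphism `e⁻¹` of a corner embedding `e`. -/
def cornerInv {A K : QRing G} (e : EHom A K) (he : IsCorner e) : (⟨K⟩ : GK G) ⟶ ⟨A⟩ :=
  cls (Word.cornerInv e he)

/-- The synthetical morphism `Δ` of a split exact sequence. -/
def delta (s : SplitExact G) : (⟨s.M⟩ : GK G) ⟶ ⟨s.B⟩ := cls (Word.delta s)

end GK

/-! ### Descent -/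

section descent

variable {G : Type u} [Group G]

/-- The crossed product `A ⋊ G` as a non-equivariant quadratik ring (that is, with an action of
the trivial group). -/
def descObj (A : QRing G) : QRing PUnit.{u + 1} where
  carrier := Crossed A.action
  action := 1
  quadratik := Crossed.quadratik A.action A.quadratik

/-- The non-equivariant homomorphism `π ⋊ 1`. -/
def descHom {A B : QRing G} (π : EHom A B) : EHom (descObj A) (descObj B) where
  toHom := Crossed.map π.toHom π.equivariant
  equivariant _ _ := rfl

/-- The split exact sequence of the crossed products of a split exact sequence. -/
def descSplit (s : SplitExact G) : SplitExact PUnit.{u + 1} where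
  B := descObj s.B
  M := descObj s.M
  A := descObj s.A
  j := descHom s.j
  f := descHom s.f
  s := descHom s.s
  injective := Crossed.map_injective _ s.j.equivariant s.injective
  exact := Crossed.map_exact _ s.j.equivariant _ s.f.equivariant s.exact
  split x := by
    induction x using Crossed.induction with
    | h0 => exact (congrArg _ (map_zero _)).trans (map_zero _)
    | hadd x y hx hy =>
      exact (congrArg _ (map_add _ x y)).trans ((map_add _ _ _).trans (congrArg₂ (· + ·) hx hy))
    | hmk a g =>
      change Crossed.map _ s.f.equivariant (Crossed.map _ s.s.equivariant (Crossed.mk _ a g)) = _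
      rw [Crossed.map_mk, Crossed.map_mk, s.split]

/-- The defining properties of the descent functor `j^G : GK^G → GK`. -/
structure IsDescentFunctor (F : GK G ⥤ GK PUnit.{u + 1}) : Prop where
  additive : F.Additive
  obj_eq : ∀ A : QRing G, F.obj ⟨A⟩ = ⟨descObj A⟩
  map_ofHom : ∀ {A B : QRing G} (π : EHom A B),
    F.map (GK.ofHom π) =
      eqToHom (obj_eq A) ≫ GK.ofHom (descHom π) ≫ eqToHom (obj_eq B).symm
  map_cornerInv : ∀ {A K : QRing G} (e : EHom A K) (he : IsCorner e),
    ∃ _ : IsIso (GK.ofHom (descHom e)),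
      F.map (GK.cornerInv e he) =
        eqToHom (obj_eq K) ≫ inv (GK.ofHom (descHom e)) ≫ eqToHom (obj_eq A).symm
  map_delta : ∀ s : SplitExact G,
    F.map (GK.delta s) =
      eqToHom (obj_eq s.M) ≫ GK.delta (descSplit s) ≫ eqToHom (obj_eq s.B).symm

end descent

end

end GKT

open GKT

/-! The module `E ⊗_A (A ⋊ G)` is the quotient of the `A ⋊ G`-module `⨁_g E ⋊ g` of finite formal
sums by the sums that are annihilated by all functionals. On formal sums, the analogue
`K(E) ⋊ G → K(⨁_g E ⋊ g)` of `σ` is always an isomorphism: it is injective because its values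
determine all coefficients `T_g`, and it is surjective because
`θ_{ξ ⋊ g, (a ⋊ h) φ} = θ_{ξ α_g(a), φ'} ⋊ gh`, where `φ'` is the translate of `φ` by `gh`. Compact
operators descend along quotient maps that do not change the functionals, and dividing out yields
`σ` with the stated kernel.

In the same way, `⨁_g (E ⊕ ⨁_i A) ⋊ g` is compared with `(⨁_g E ⋊ g) ⊕ ⨁_i (A ⋊ G)`. All functionals
on the former come from the latter; the converse needs `I` to be finite, since the entries of an
infinite family in `A ⋊ G` can be supported on infinitely many group elements. Therefore, in order
to recognize `e ⋊ 1` as a corner embedding for arbitrary `I`, all coordinates but `i₀` are first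
absorbed into the module; with formal sums in place of the tensor product, no separation hypothesis
is needed.

For the functor, each defining relation of `GK^G` is carried to a relation of `GK`. It is unique
because an additive functor is determined on `e⁻¹` and `Δ` by its values on ring homomorphisms:
`e⁻¹` is an inverse, and `Δ` is determined by `j Δ = 1` and `Δ j = 1 - f s`. -/

namespace GKT

noncomputable section

/-! ### Coverings of functional modules -/

theorem IsQuadratik.mem_of_mul_mem {A : Type u} [NonUnitalRing A] (hA : IsQuadratik A)
    {K : AddSubgroup A} (h : ∀ b c, b * c ∈ K) (a : A) : a ∈ K :=
  (AddSubgroup.closure_le K).2 (by rintro _ ⟨b, c, rfl⟩; exact h b c) (hA a)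

namespace FModule

variable {A : Type u} [NonUnitalRing A] {D E F : FModule A}

/-- A functional module is nondegenerate if every element is a finite sum of products `ξ a`. This is
what the proof needs of cofullness, and unlike cofullness it passes to direct summands. -/
def Nondegenerate (E : FModule A) : Prop :=
  ∀ ζ : E, ζ ∈ AddSubgroup.closure {z : E | ∃ ξ a, z = E.act ξ a}

theorem Nondegenerate.mem_of_act_mem (hE : E.Nondegenerate) {K : AddSubgroup E}
    (h : ∀ ξ a, E.act ξ a ∈ K) (ζ : E) : ζ ∈ K :=
  (AddSubgroup.closure_le K).2 (by rintro _ ⟨ξ, a, rfl⟩; exact h ξ a) (hE ζ)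

theorem Cofull.mem_of_act_mem (hE : E.Cofull) {K : AddSubgroup E}
    (h : ∀ ξ η, ∀ φ ∈ E.functionals, E.act ξ (φ η) ∈ K) (ζ : E) : ζ ∈ K :=
  (AddSubgroup.closure_le K).2 (by rintro _ ⟨ξ, η, φ, hφ, rfl⟩; exact h ξ η φ hφ) (hE ζ)

theorem Cofull.nondegenerate (hE : E.Cofull) : E.Nondegenerate := fun _ =>
  hE.mem_of_act_mem (K := .closure {z : E | ∃ ξ a, z = E.act ξ a})
    (fun ξ η φ _ => AddSubgroup.subset_closure ⟨ξ, φ η, rfl⟩) _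

theorem Nondegenerate.fst (h : (E.prod F).Nondegenerate) : E.Nondegenerate := fun ξ =>
  h.mem_of_act_mem
    (K := AddSubgroup.comap (AddMonoidHom.fst E F) (.closure {z : E | ∃ ξ a, z = E.act ξ a}))
    (fun ζ a => AddSubgroup.subset_closure ⟨ζ.1, a, rfl⟩) ((ξ, 0) : E × F)

theorem Separated.fst (h : (E.prod F).Separated) : E.Separated := fun ξ hξ =>
  congrArg Prod.fst (h ((ξ, 0) : E × F) (by
    rintro _ ⟨φ, hφ, ψ, -, rfl⟩
    exact (AddMonoidHom.coprod_apply φ ψ _).trans (by simp [hξ φ hφ])))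

theorem theta_mem_compacts (η : E) {φ : E →+ A} (hφ : φ ∈ E.functionals) :
    E.theta η φ ∈ E.compacts :=
  AddSubgroup.subset_closure ⟨η, φ, hφ, rfl⟩

theorem mem_of_theta_mem {K : AddSubgroup (AddMonoid.End E)}
    (h : ∀ η, ∀ φ ∈ E.functionals, E.theta η φ ∈ K) {T : AddMonoid.End E} (hT : T ∈ E.compacts) :
    T ∈ K :=
  (AddSubgroup.closure_le K).2 (by rintro _ ⟨η, φ, hφ, rfl⟩; exact h η φ hφ) hT

theorem compacts_apply_act (T : E.compacts) (ξ : E) (a : A) :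
    (T : AddMonoid.End E) (E.act ξ a) = E.act ((T : AddMonoid.End E) ξ) a :=
  mem_of_theta_mem (K := ((AddMonoidHom.eval (E.act ξ a)).eqLocus
      ((E.act.flip a).comp (AddMonoidHom.eval ξ)) : AddSubgroup (E →+ E)))
    (fun η φ hφ => show E.act η (φ (E.act ξ a)) = E.act (E.act η (φ ξ)) a by
      rw [E.functionals_act φ hφ, E.act_mul]) T.2

/-- A covering of functional modules is a surjective module homomorphism `p : E → F` such that every
functional on `E` is the pullback of a functional on `F`. Compact operators descend along
coverings. -/
structure IsCovering (p : E →+ F) : Prop where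
  surjective : Function.Surjective p
  map_act : ∀ ξ a, p (E.act ξ a) = F.act (p ξ) a
  exists_comp_eq : ∀ ψ ∈ E.functionals, ∃ φ ∈ F.functionals, φ.comp p = ψ

/-- A covering is a quotient map if moreover all functionals on the target pull back to functionals
on the source. -/
structure IsQuotient (p : E →+ F) : Prop extends IsCovering p where
  comp_mem : ∀ φ ∈ F.functionals, φ.comp p ∈ E.functionals

namespace IsCovering

variable {p : E →+ F}

theorem exists_compact (hp : IsCovering p) (T : E.compacts) :
    ∃ T' ∈ F.compacts, ∀ ξ, T' (p ξ) = p ((T : AddMonoid.End E) ξ) := by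
  obtain ⟨T', hT', h⟩ := mem_of_theta_mem (T := T)
    (K := (F.compacts.toAddSubgroup.map (AddMonoidHom.compHom.flip p : (F →+ F) →+ (E →+ F))).comap
      (AddMonoidHom.compHom p : (E →+ E) →+ (E →+ F))) (fun η ψ hψ => by
        obtain ⟨φ, hφ, rfl⟩ := hp.exists_comp_eq ψ hψ
        exact ⟨_, theta_mem_compacts (p η) hφ, AddMonoidHom.ext fun ξ => (hp.map_act _ _).symm⟩) T.2
  exact ⟨T', hT', DFunLike.congr_fun h⟩

theorem compacts_ext (hp : IsCovering p) {T U : F.compacts}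
    (h : ∀ ξ, (T : AddMonoid.End F) (p ξ) = (U : AddMonoid.End F) (p ξ)) : T = U :=
  Subtype.ext (AddMonoidHom.ext (hp.surjective.forall.2 h))

/-- The ring homomorphism `K(E) → K(F)` induced by a covering `p : E → F`; it maps `T` to the
operator `T'` with `T' ∘ p = p ∘ T`. -/
def compactsMap (hp : IsCovering p) : E.compacts →ₙ+* F.compacts :=
  have apply_map (T : E.compacts) := (hp.exists_compact T).choose_spec.2
  { toFun := fun T => ⟨(hp.exists_compact T).choose, (hp.exists_compact T).choose_spec.1⟩
    map_mul' := fun T U => hp.compacts_ext fun ξ => (apply_map (T * U) ξ).trans (by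
      change p (T.1 (U.1 ξ)) = (hp.exists_compact T).choose ((hp.exists_compact U).choose (p ξ))
      rw [apply_map, apply_map])
    map_zero' := hp.compacts_ext fun ξ => (apply_map 0 ξ).trans (map_zero p)
    map_add' := fun T U => hp.compacts_ext fun ξ => (apply_map (T + U) ξ).trans (by
      change p (T.1 ξ + U.1 ξ) =
        (hp.exists_compact T).choose (p ξ) + (hp.exists_compact U).choose (p ξ)
      rw [apply_map, apply_map, map_add]) }

theorem compactsMap_apply (hp : IsCovering p) (T : E.compacts) (ξ : E) :
    (hp.compactsMap T : AddMonoid.End F) (p ξ) = p ((T : AddMonoid.End E) ξ) :=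
  (hp.exists_compact T).choose_spec.2 ξ

theorem compactsMap_eq_zero_iff (hp : IsCovering p) (T : E.compacts) :
    hp.compactsMap T = 0 ↔ ∀ ξ, p ((T : AddMonoid.End E) ξ) = 0 := by
  refine ⟨fun h ξ => ?_, fun h => hp.compacts_ext fun ξ => (hp.compactsMap_apply T ξ).trans (h ξ)⟩
  rw [← hp.compactsMap_apply, h]
  rfl

theorem compactsMap_injective (hp : IsCovering p) (h : Function.Injective p) :
    Function.Injective hp.compactsMap :=
  (injective_iff_map_eq_zero _).2 fun T hT => Subtype.ext <| AddMonoidHom.ext fun ξ =>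
    h (((hp.compactsMap_eq_zero_iff T).1 hT ξ).trans (map_zero p).symm)

theorem cofull (hp : IsCovering p) (hE : E.Cofull) : F.Cofull := by
  refine hp.surjective.forall.2 fun ζ => hE.mem_of_act_mem (K := AddSubgroup.comap p
    (AddSubgroup.closure _)) (fun ξ η ψ hψ => AddSubgroup.subset_closure ?_) ζ
  obtain ⟨φ, hφ, rfl⟩ := hp.exists_comp_eq ψ hψ
  exact ⟨p ξ, p η, φ, hφ, hp.map_act _ _⟩

theorem comp {q : D →+ E} (hp : IsCovering p) (hq : IsCovering q) : IsCovering (p.comp q) where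
  surjective := hp.surjective.comp hq.surjective
  map_act ξ a := (congrArg p (hq.map_act ξ a)).trans (hp.map_act _ a)
  exists_comp_eq := by
    intro χ hχ
    obtain ⟨ψ, hψ, rfl⟩ := hq.exists_comp_eq χ hχ
    obtain ⟨φ, hφ, rfl⟩ := hp.exists_comp_eq ψ hψ
    exact ⟨φ, hφ, rfl⟩

end IsCovering

namespace IsQuotient

variable {p : E →+ F}

theorem id (E : FModule A) : IsQuotient (AddMonoidHom.id E) :=
  ⟨⟨Function.surjective_id, fun _ _ => rfl, fun ψ hψ => ⟨ψ, hψ, rfl⟩⟩, fun _ hφ => hφ⟩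

theorem comp {q : D →+ E} (hp : IsQuotient p) (hq : IsQuotient q) : IsQuotient (p.comp q) where
  __ := hp.toIsCovering.comp hq.toIsCovering
  comp_mem φ hφ := hq.comp_mem _ (hp.comp_mem φ hφ)

theorem compactsMap_surjective (hp : IsQuotient p) : Function.Surjective hp.compactsMap := by
  intro T
  obtain ⟨U, hU⟩ := mem_of_theta_mem (T := T)
    (K := (F.compacts.toAddSubgroup.subtype.comp hp.compactsMap.toAddMonoidHom).range) (by
      refine hp.surjective.forall.2 fun η φ hφ => ⟨⟨_, theta_mem_compacts η (hp.comp_mem φ hφ)⟩, ?_⟩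
      refine AddMonoidHom.ext (hp.surjective.forall.2 fun ξ => ?_)
      exact (hp.compactsMap_apply _ ξ).trans (hp.map_act _ _)) T.2
  exact ⟨U, Subtype.ext hU⟩

/-- A bijective quotient map identifies the rings of compact operators. -/
def compactsEquiv (hp : IsQuotient p) (h : Function.Injective p) : E.compacts ≃+* F.compacts :=
  RingEquiv.ofBijective hp.compactsMap ⟨hp.compactsMap_injective h, hp.compactsMap_surjective⟩

theorem isCovering_of_comp {q : D →+ E} (hq : IsQuotient q) (h : IsCovering (p.comp q)) :
    IsCovering p where
  surjective := .of_comp h.surjective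
  map_act := hq.surjective.forall.2 fun ξ a => by
    rw [← hq.map_act]; exact h.map_act ξ a
  exists_comp_eq ψ hψ := by
    obtain ⟨φ, hφ, hφψ⟩ := h.exists_comp_eq _ (hq.comp_mem ψ hψ)
    exact ⟨φ, hφ, (AddMonoidHom.cancel_right hq.surjective).1 hφψ⟩

theorem of_comp {q : D →+ E} (hq : IsQuotient q) (h : IsQuotient (p.comp q)) : IsQuotient p where
  __ := hq.isCovering_of_comp h.toIsCovering
  comp_mem φ hφ := by
    obtain ⟨ψ, hψ, hψφ⟩ := hq.exists_comp_eq _ (h.comp_mem φ hφ)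
    rwa [← (AddMonoidHom.cancel_right (g₂ := φ.comp p) hq.surjective).1 hψφ]

end IsQuotient

theorem IsCovering.prodMap {E' F' : FModule A} {p : E →+ F} {q : E' →+ F'} (hp : IsCovering p)
    (hq : IsCovering q) :
    IsCovering (E := E.prod E') (F := F.prod F') (AddMonoidHom.prodMap p q) where
  surjective := hp.surjective.prodMap hq.surjective
  map_act ξ a := Prod.ext (hp.map_act ξ.1 a) (hq.map_act ξ.2 a)
  exists_comp_eq := by
    rintro _ ⟨φ, hφ, ψ, hψ, rfl⟩
    obtain ⟨φ', hφ', rfl⟩ := hp.exists_comp_eq φ hφ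
    obtain ⟨ψ', hψ', rfl⟩ := hq.exists_comp_eq ψ hψ
    exact ⟨_, ⟨φ', hφ', ψ', hψ', rfl⟩, rfl⟩

theorem IsQuotient.prodMap {E' F' : FModule A} {p : E →+ F} {q : E' →+ F'} (hp : IsQuotient p)
    (hq : IsQuotient q) :
    IsQuotient (E := E.prod E') (F := F.prod F') (AddMonoidHom.prodMap p q) where
  __ := hp.toIsCovering.prodMap hq.toIsCovering
  comp_mem := by
    rintro _ ⟨φ, hφ, ψ, hψ, rfl⟩
    exact ⟨_, hp.comp_mem φ hφ, _, hq.comp_mem ψ hψ, rfl⟩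

end FModule

/-! ### Formal sums over the group -/

variable {G : Type u} [Group G] {A : Type u} [NonUnitalRing A]

namespace Crossed

variable {α : G →* RingAut A}

theorem mem_of_mk_mem {K : AddSubgroup (Crossed α)} (h : ∀ a g, mk α a g ∈ K) (x : Crossed α) :
    x ∈ K :=
  induction x (zero_mem K) (fun _ _ => add_mem) h

theorem hom_ext {M : Type*} [AddCommGroup M] {f f' : Crossed α →+ M}
    (h : ∀ a g, f (mk α a g) = f' (mk α a g)) : f = f' :=
  AddMonoidHom.ext (mem_of_mk_mem (K := f.eqLocus f') h)

theorem coeff_mk_same (a : A) (g : G) : coeff (mk α a g) g = a := Finsupp.single_eq_same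

theorem coeff_mk_of_ne {g h : G} (hgh : h ≠ g) (a : A) : coeff (mk α a g) h = 0 :=
  Finsupp.single_eq_of_ne hgh

theorem map_mul_of_mk {R : Type*} [NonUnitalNonAssocRing R] (f : Crossed α →+ R)
    (h : ∀ a b g k, f (mk α a g * mk α b k) = f (mk α a g) * f (mk α b k)) (x y : Crossed α) :
    f (x * y) = f x * f y := by
  induction x using induction with
  | h0 => simp only [zero_mul, map_zero]
  | hadd x x' hx hx' => simp only [add_mul, map_add, hx, hx']
  | hmk a g =>
    induction y using induction with
    | h0 => simp only [mul_zero, map_zero]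
    | hadd y y' hy hy' => simp only [mul_add, map_add, hy, hy']
    | hmk b k => exact h a b g k

end Crossed

namespace ModAction

variable {α : G →* RingAut A} {E : FModule A}

/-- The translate `α_g ∘ φ ∘ S_{g⁻¹}` of a functional `φ`. -/
def translate (S : ModAction α E) (g : G) (φ : E →+ A) : E →+ A :=
  ((α g : A ≃+ A).toAddMonoidHom.comp φ).comp (S.S g⁻¹)

theorem translate_apply_S (S : ModAction α E) (g : G) (φ : E →+ A) (ξ : E) :
    S.translate g φ (S.S g ξ) = α g (φ ξ) :=
  congrArg (fun η => α g (φ η)) (S.S_inv_apply g ξ)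

theorem translate_translate_inv (S : ModAction α E) (g : G) (φ : E →+ A) :
    S.translate g (S.translate g⁻¹ φ) = φ := by
  ext ξ
  change α g (α g⁻¹ (φ (S.S g⁻¹⁻¹ (S.S g⁻¹ ξ)))) = φ ξ
  rw [S.S_inv_apply, ← RingAut.mul_apply, ← map_mul, mul_inv_cancel, map_one, RingAut.one_apply]

end ModAction

section crossModule

variable (α : G →* RingAut A) (E : FModule A)

/-- The right action `(ξ ⋊ g) (b ⋊ h) = ξ α_g(b) ⋊ g h` of the crossed product on `G →₀ E`. -/
def crossAct : (G →₀ E) →+ Crossed α →+ (G →₀ E) :=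
  AddMonoidHom.flip (Crossed.lift α fun h => AddMonoidHom.mk'
    (fun b => Finsupp.liftAddHom fun g =>
      (Finsupp.singleAddHom (g * h)).comp (E.act.flip (α g b))) (by intro a b; ext; simp))

theorem crossAct_single_mk (g h : G) (ξ : E) (b : A) :
    crossAct α E (Finsupp.single g ξ) (Crossed.mk α b h) =
      Finsupp.single (g * h) (E.act ξ (α g b)) := by
  simp [crossAct]

variable {E} in
/-- The map `ξ ⋊ g ↦ φ(ξ) ⋊ g` induced by a functional `φ`. -/
def crossEval (φ : E →+ A) : (G →₀ E) →+ Crossed α := Finsupp.mapRange.addMonoidHom φ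

variable {α E} in
theorem crossEval_single (φ : E →+ A) (g : G) (ξ : E) :
    crossEval α φ (Finsupp.single g ξ) = Crossed.mk α (φ ξ) g :=
  Finsupp.mapRange_single (hf := map_zero φ)

variable {α E} in
theorem crossEval_act {φ : E →+ A} (hφ : ∀ ξ a, φ (E.act ξ a) = φ ξ * a) (z : G →₀ E)
    (x : Crossed α) : crossEval α φ (crossAct α E z x) = crossEval α φ z * x := by
  induction x using Crossed.induction with
  | h0 => simp only [map_zero, mul_zero]
  | hadd x y hx hy => simp only [map_add, mul_add, hx, hy]
  | hmk b h =>
    induction z using Finsupp.induction_linear with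
    | zero => simp only [map_zero, AddMonoidHom.zero_apply, zero_mul]
    | add z w hz hw => simp only [map_add, AddMonoidHom.add_apply, add_mul, hz, hw]
    | single g ξ =>
      rw [crossAct_single_mk, crossEval_single, crossEval_single, Crossed.mk_mul_mk, hφ]

/-- The functional `A ⋊ G`-module of finite formal sums `∑ ξ_g ⋊ g` with coefficients in `E`. It is
a model of `E ⊗_A (A ⋊ G)` before elements annihilated by all functionals are divided out, and
`ξ ⋊ g` corresponds to `ξ ⊗ (1 ⋊ g)`. -/
def crossModule : FModule (Crossed α) where
  carrier := G →₀ E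
  act := crossAct α E
  act_mul z x y := by
    induction x using Crossed.induction with
    | h0 => simp only [map_zero, zero_mul, AddMonoidHom.zero_apply]
    | hadd x x' hx hx' => simp only [map_add, add_mul, AddMonoidHom.add_apply, hx, hx']
    | hmk a g =>
      induction y using Crossed.induction with
      | h0 => simp only [map_zero, mul_zero]
      | hadd y y' hy hy' => simp only [map_add, mul_add, hy, hy']
      | hmk b h =>
        induction z using Finsupp.induction_linear with
        | zero => simp only [map_zero, AddMonoidHom.zero_apply]
        | add z w hz hw => simp only [map_add, AddMonoidHom.add_apply, hz, hw]
        | single k ξ => simp only [Crossed.mk_mul_mk, crossAct_single_mk, map_mul, E.act_mul,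
            mul_assoc, RingAut.mul_apply]
  functionals := AddSubgroup.closure {χ | ∃ c : Crossed α, ∃ φ ∈ E.functionals,
    χ = (AddMonoidHom.mulLeft c).comp (crossEval α φ)}
  functionals_act χ hχ z x := by
    induction hχ using AddSubgroup.closure_induction with
    | mem χ hχ =>
      obtain ⟨c, φ, hφ, rfl⟩ := hχ
      exact (congrArg (c * ·) (crossEval_act (E.functionals_act φ hφ) z x)).trans
        (mul_assoc _ _ _).symm
    | zero => exact (zero_mul x).symm
    | add χ ψ _ _ hχ hψ => exact (congrArg₂ (· + ·) hχ hψ).trans (add_mul _ _ x).symm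
    | neg χ _ hχ => exact (congrArg (- ·) hχ).trans (neg_mul _ x).symm
  functionals_smul x χ hχ := by
    induction hχ using AddSubgroup.closure_induction with
    | mem χ hχ =>
      obtain ⟨c, φ, hφ, rfl⟩ := hχ
      exact AddSubgroup.subset_closure
        ⟨x * c, φ, hφ, AddMonoidHom.ext fun z => (mul_assoc x c _).symm⟩
    | zero => rw [AddMonoidHom.comp_zero]; exact zero_mem _
    | add χ ψ _ _ hχ hψ => rw [AddMonoidHom.comp_add]; exact add_mem hχ hψ
    | neg χ _ hχ => rw [AddMonoidHom.comp_neg]; exact neg_mem hχ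

variable {E} in
/-- The inclusion `ξ ↦ ξ ⋊ g`. -/
def crossSingle (g : G) : E →+ crossModule α E := Finsupp.singleAddHom g

variable {α E} in
/-- The coefficient `∑ ξ_h ⋊ h ↦ ξ_g`. -/
def crossCoeff (g : G) : crossModule α E →+ E := Finsupp.applyAddHom (M := E) g

namespace crossModule

variable {α E}

theorem ext {z w : crossModule α E} (h : ∀ g, crossCoeff g z = crossCoeff g w) : z = w :=
  Finsupp.ext h

theorem coeff_single_same (g : G) (ξ : E) : crossCoeff g (crossSingle α g ξ) = ξ :=
  Finsupp.single_eq_same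

theorem coeff_single_of_ne {g h : G} (hgh : h ≠ g) (ξ : E) :
    crossCoeff h (crossSingle α g ξ) = 0 :=
  Finsupp.single_eq_of_ne hgh

theorem mem_of_single_mem {K : AddSubgroup (crossModule α E)}
    (h : ∀ g ξ, crossSingle α g ξ ∈ K) (z : crossModule α E) : z ∈ K :=
  Finsupp.induction_linear (motive := (· ∈ K)) z (zero_mem K) (fun _ _ => add_mem) h

theorem hom_ext {M : Type*} [AddCommGroup M] {f f' : crossModule α E →+ M}
    (h : ∀ g ξ, f (crossSingle α g ξ) = f' (crossSingle α g ξ)) : f = f' :=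
  Finsupp.addHom_ext h

theorem end_ext {T U : AddMonoid.End (crossModule α E)}
    (h : ∀ g ξ, T (crossSingle α g ξ) = U (crossSingle α g ξ)) : T = U :=
  hom_ext h

theorem act_single_mk (g h : G) (ξ : E) (b : A) :
    (crossModule α E).act (crossSingle α g ξ) (Crossed.mk α b h) =
      crossSingle α (g * h) (E.act ξ (α g b)) :=
  crossAct_single_mk α E g h ξ b

theorem act_one_mk (g : G) (ξ : E) (b : A) :
    (crossModule α E).act (crossSingle α 1 ξ) (Crossed.mk α b g) = crossSingle α g (E.act ξ b) := by
  rw [act_single_mk, one_mul, map_one, RingAut.one_apply]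

theorem mulLeft_comp_crossEval_mem (c : Crossed α) {φ : E →+ A} (hφ : φ ∈ E.functionals) :
    (AddMonoidHom.mulLeft c).comp (crossEval α φ) ∈ (crossModule α E).functionals :=
  AddSubgroup.subset_closure ⟨c, φ, hφ, rfl⟩

theorem functionals_le {K : AddSubgroup (crossModule α E →+ Crossed α)}
    (h : ∀ a g, ∀ φ ∈ E.functionals,
      (AddMonoidHom.mulLeft (Crossed.mk α a g)).comp (crossEval α φ) ∈ K) :
    (crossModule α E).functionals ≤ K := by
  refine (AddSubgroup.closure_le K).2 ?_
  rintro _ ⟨c, φ, hφ, rfl⟩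
  exact Crossed.mem_of_mk_mem (K := K.comap
    ((AddMonoidHom.compHom.flip (crossEval α φ)).comp AddMonoidHom.mul)) (fun a g => h a g φ hφ) c

theorem cofull (hE : E.Cofull) : (crossModule α E).Cofull := by
  let K : AddSubgroup (crossModule α E) := .closure
    {z | ∃ x y, ∃ χ ∈ (crossModule α E).functionals, z = (crossModule α E).act x (χ y)}
  refine mem_of_single_mem (K := K) fun g => ?_
  refine hE.mem_of_act_mem (K := K.comap (crossSingle α g)) fun ξ η φ hφ => ?_
  refine hE.nondegenerate.mem_of_act_mem
    (K := K.comap ((crossSingle α g).comp (E.act.flip (φ η)))) (fun ξ a => ?_) ξ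
  refine AddSubgroup.subset_closure ⟨crossSingle α 1 ξ, crossSingle α g η, _,
    mulLeft_comp_crossEval_mem (Crossed.mk α a 1) hφ, ?_⟩
  change crossSingle α g (E.act (E.act ξ a) (φ η)) = (crossModule α E).act _
    (Crossed.mk α a 1 * crossEval α φ (Finsupp.single g η))
  rw [crossEval_single, Crossed.mk_mul_mk, map_one, RingAut.one_apply, one_mul, act_one_mk,
    E.act_mul]

end crossModule

end crossModule

section crossCompacts

variable {α : G →* RingAut A} {E : FModule A} (S : ModAction α E)

/-- The operator `ξ ⋊ h ↦ T(S_g ξ) ⋊ g h` for an additive endomorphism `T` of `E`. -/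
def crossOp (g : G) : AddMonoid.End E →+ AddMonoid.End (crossModule α E) :=
  (Finsupp.liftAddHom (M := E) (N := crossModule α E)).toAddMonoidHom.comp <|
    AddMonoidHom.pi fun h => (AddMonoidHom.compHom (crossSingle α (g * h))).comp
      (AddMonoidHom.compHom.flip (S.S g : E →+ E))

theorem crossOp_single (g h : G) (T : AddMonoid.End E) (ξ : E) :
    crossOp S g T (crossSingle α h ξ) = crossSingle α (g * h) (T (S.S g ξ)) :=
  Finsupp.liftAddHom_apply_single _ _ _

theorem crossOp_theta (g h : G) (ξ : E) (a : A) (φ : E →+ A) :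
    crossOp S (g * h) (E.theta (E.act ξ (α g a)) (S.translate (g * h) φ)) =
      (crossModule α E).theta (crossSingle α g ξ)
        ((AddMonoidHom.mulLeft (Crossed.mk α a h)).comp (crossEval α φ)) := by
  refine crossModule.end_ext fun k η => ?_
  rw [crossOp_single]
  change crossSingle α _ (E.act (E.act ξ (α g a)) (S.translate _ φ (S.S _ η))) =
    (crossModule α E).act _ (Crossed.mk α a h * crossEval α φ (Finsupp.single k η))
  rw [S.translate_apply_S, crossEval_single, Crossed.mk_mul_mk, crossModule.act_single_mk,
    ← E.act_mul, map_mul α, RingAut.mul_apply, ← map_mul (α g), mul_assoc]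

theorem crossOp_mem_compacts (hE : E.Nondegenerate) (g : G) {T : AddMonoid.End E}
    (hT : T ∈ E.compacts) : crossOp S g T ∈ (crossModule α E).compacts := by
  let K : AddSubgroup (AddMonoid.End E) :=
    (crossModule α E).compacts.toAddSubgroup.comap (crossOp S g)
  refine FModule.mem_of_theta_mem (K := K) (fun η φ hφ => ?_) hT
  refine hE.mem_of_act_mem
    (K := K.comap ((AddMonoidHom.compHom.comp E.act).flip φ)) (fun ξ a => ?_) η
  have h := crossOp_theta S 1 g ξ a (S.translate g⁻¹ φ)
  rw [one_mul, map_one, RingAut.one_apply, S.translate_translate_inv] at h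
  change crossOp S g (E.theta (E.act ξ a) φ) ∈ (crossModule α E).compacts
  rw [h]
  exact FModule.theta_mem_compacts _
    (crossModule.mulLeft_comp_crossEval_mem _ (S.invariant g⁻¹ φ hφ))

/-- The representation `T ⋊ g ↦ (ξ ⋊ h ↦ T(S_g ξ) ⋊ g h)` of `K(E) ⋊ G`. -/
def crossRep : Crossed S.Ad →ₙ+* AddMonoid.End (crossModule α E) where
  __ := Crossed.lift S.Ad fun g => (crossOp S g).comp E.compacts.toAddSubgroup.subtype
  map_mul' := Crossed.map_mul_of_mk _ fun T U g h => by
    rw [Crossed.mk_mul_mk, Crossed.lift_mk, Crossed.lift_mk, Crossed.lift_mk]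
    refine crossModule.end_ext fun k ξ => ?_
    change crossOp S (g * h) (T.1 * (S.S g * U.1 * S.S g⁻¹)) (crossSingle α k ξ) =
      crossOp S g T.1 (crossOp S h U.1 (crossSingle α k ξ))
    rw [crossOp_single, crossOp_single, crossOp_single, map_mul, mul_assoc]
    exact congrArg (fun η => crossSingle α _ (T.1 (S.S g (U.1 η)))) (S.S_inv_apply g _)

variable {S}

theorem crossRep_mk (T : E.compacts) (g : G) :
    crossRep S (Crossed.mk S.Ad T g) = crossOp S g T :=
  Crossed.lift_mk _ _ _ _

theorem coeff_crossRep_single (x : Crossed S.Ad) (g h : G) (ξ : E) :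
    crossCoeff (g * h) (crossRep S x (crossSingle α h ξ)) = (Crossed.coeff x g).1 (S.S g ξ) := by
  induction x using Crossed.induction with
  | h0 => rw [map_zero]; exact map_zero _
  | hadd x y hx hy => rw [map_add]; exact (map_add _ _ _).trans (congrArg₂ (· + ·) hx hy)
  | hmk T k =>
    rw [crossRep_mk, crossOp_single]
    obtain rfl | hgk := eq_or_ne g k
    · rw [crossModule.coeff_single_same, Crossed.coeff_mk_same]
    · rw [crossModule.coeff_single_of_ne (mul_left_injective h |>.ne hgk),
        Crossed.coeff_mk_of_ne hgk]
      rfl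

theorem crossRep_injective : Function.Injective (crossRep S) := by
  refine (injective_iff_map_eq_zero _).2 fun x hx => Crossed.ext fun g => ?_
  refine Subtype.ext (AddMonoidHom.ext fun ξ => ?_)
  have h := coeff_crossRep_single x g 1 (S.S g⁻¹ ξ)
  rw [hx, S.S_apply_inv] at h
  exact h.symm.trans (map_zero _)

theorem crossRep_mem_compacts (hE : E.Nondegenerate) (x : Crossed S.Ad) :
    crossRep S x ∈ (crossModule α E).compacts := by
  refine Crossed.mem_of_mk_mem (K := (crossModule α E).compacts.toAddSubgroup.comap
    (crossRep S).toAddMonoidHom) (fun T g => ?_) x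
  change crossRep S _ ∈ (crossModule α E).compacts
  rw [crossRep_mk]
  exact crossOp_mem_compacts S hE g T.2

theorem exists_crossRep_eq {T : AddMonoid.End (crossModule α E)}
    (hT : T ∈ (crossModule α E).compacts) : ∃ x, crossRep S x = T := by
  let K : AddSubgroup (AddMonoid.End (crossModule α E)) := (crossRep S).toAddMonoidHom.range
  refine FModule.mem_of_theta_mem (K := K) (fun z χ hχ => ?_) hT
  let Θ : crossModule α E →+ (crossModule α E →+ Crossed α) →+ AddMonoid.End (crossModule α E) :=
    AddMonoidHom.compHom.comp (crossModule α E).act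
  refine crossModule.mem_of_single_mem (K := K.comap (Θ.flip χ)) (fun g ξ => ?_) z
  refine crossModule.functionals_le (K := K.comap (Θ (crossSingle α g ξ))) (fun a h φ hφ => ?_) hχ
  refine ⟨Crossed.mk S.Ad ⟨_, FModule.theta_mem_compacts (E.act ξ (α g a))
    (S.invariant (g * h) φ hφ)⟩ (g * h), ?_⟩
  exact (crossRep_mk _ _).trans (crossOp_theta S g h ξ a φ)

/-- The isomorphism `K(E) ⋊ G ≅ K(⨁_g E ⋊ g)`. -/
def crossCompactsEquiv (S : ModAction α E) (hE : E.Nondegenerate) :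
    Crossed S.Ad ≃+* (crossModule α E).compacts :=
  RingEquiv.ofBijective
    (NonUnitalRingHom.codRestrict (crossRep S) (crossModule α E).compacts
      (crossRep_mem_compacts hE))
    ⟨fun _ _ h => crossRep_injective (congrArg Subtype.val h),
      fun T => (exists_crossRep_eq T.2).imp fun _ => Subtype.ext⟩

end crossCompacts

/-! ### The internal tensor product with the crossed product -/

section descentModule

open FModule

variable {α : G →* RingAut A} {E : FModule A}

variable (α E) in
/-- The map `ξ ⊗ x ↦ (ξ ⋊ 1) x`. -/
def tensorToCross : E ⊗[ℤ] self (Crossed α) →+ crossModule α E :=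
  TensorProduct.liftAddHom (N := self (Crossed α)) ((crossModule α E).act.comp (crossSingle α 1))
    fun r ξ x => (DFunLike.congr_fun
      (map_zsmul ((crossModule α E).act.comp (crossSingle α 1)) r ξ) x).trans
        (map_zsmul ((crossModule α E).act (crossSingle α 1 ξ)) r x).symm

theorem tensorToCross_surjective (hE : E.Nondegenerate) :
    Function.Surjective (tensorToCross α E) := by
  intro z
  refine crossModule.mem_of_single_mem (K := (tensorToCross α E).range) (fun g ξ => ?_) z
  exact hE.mem_of_act_mem (K := (tensorToCross α E).range.comap (crossSingle α g))
    (fun ξ a => ⟨ξ ⊗ₜ[ℤ] (Crossed.mk α a g : self (Crossed α)), crossModule.act_one_mk g ξ a⟩) ξ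

theorem crossEval_tensorToCross {φ : E →+ A} (hφ : φ ∈ E.functionals)
    (t : E ⊗[ℤ] self (Crossed α)) : crossEval α φ (tensorToCross α E t) =
      tensorEval E (self (Crossed α)) (Crossed.leftMul α) φ t := by
  induction t using TensorProduct.induction_on with
  | zero => rw [map_zero, map_zero]; exact map_zero _
  | add s t hs ht => rw [map_add, map_add, ← hs, ← ht]; exact map_add _ _ _
  | tmul ξ x =>
    refine (crossEval_act (E.functionals_act φ hφ) (Finsupp.single 1 ξ) x).trans ?_
    rw [crossEval_single]
    rfl

theorem tensorToCross_right (t : E ⊗[ℤ] self (Crossed α)) (x : Crossed α) :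
    tensorToCross α E (tensorRight E (self (Crossed α)) x t) =
      (crossModule α E).act (tensorToCross α E t) x := by
  induction t using TensorProduct.induction_on with
  | zero => simp only [map_zero, AddMonoidHom.zero_apply]
  | add s t hs ht => simp only [map_add, AddMonoidHom.add_apply, hs, ht]
  | tmul ξ y => exact (crossModule α E).act_mul _ _ _

theorem ker_tensorToCross_le : (tensorToCross α E).ker ≤
    (QuotientAddGroup.mk' (tensorNull E (self (Crossed α)) (Crossed.leftMul α))).ker := by
  intro t ht
  rw [QuotientAddGroup.ker_mk']
  intro φ hφ
  rw [← crossEval_tensorToCross hφ, AddMonoidHom.mem_ker.1 ht]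
  exact map_zero _

/-- The quotient map from formal sums `∑ ξ_g ⋊ g` to `E ⊗_A (A ⋊ G)`, which sends `(ξ ⋊ 1) x` to
`ξ ⊗ x`. -/
def crossToDescent (hE : E.Nondegenerate) : crossModule α E →+ descentModule α E :=
  AddMonoidHom.liftOfSurjective _ (tensorToCross_surjective hE) ⟨_, ker_tensorToCross_le⟩

theorem crossToDescent_tensorToCross (hE : E.Nondegenerate) (t : E ⊗[ℤ] self (Crossed α)) :
    crossToDescent hE (tensorToCross α E t) =
      (t : (E ⊗[ℤ] self (Crossed α)) ⧸ tensorNull E _ (Crossed.leftMul α)) :=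
  AddMonoidHom.liftOfRightInverse_comp_apply _ _ _ _ _

theorem crossToDescent_act_single_one (hE : E.Nondegenerate) (ξ : E) (x : Crossed α) :
    crossToDescent hE ((crossModule α E).act (crossSingle α 1 ξ) x) = descentTmul α E ξ x :=
  crossToDescent_tensorToCross hE (ξ ⊗ₜ[ℤ] (x : self (Crossed α)))

theorem crossToDescent_eq_zero_iff (hE : E.Nondegenerate) (z : crossModule α E) :
    crossToDescent hE z = 0 ↔ ∀ φ ∈ E.functionals, ∀ g, φ (crossCoeff g z) = 0 := by
  obtain ⟨t, rfl⟩ := tensorToCross_surjective hE z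
  rw [crossToDescent_tensorToCross]
  refine (QuotientAddGroup.eq_zero_iff t).trans (forall₂_congr fun φ hφ => ?_)
  rw [← crossEval_tensorToCross hφ]
  exact ⟨fun h g => congrArg (Crossed.coeff · g) h, fun h => Crossed.ext h⟩

theorem crossToDescent_injective (hE : E.Nondegenerate) (h : E.Separated) :
    Function.Injective (crossToDescent (α := α) hE) :=
  (injective_iff_map_eq_zero _).2 fun z hz => crossModule.ext fun g => h _ fun φ hφ =>
    (crossToDescent_eq_zero_iff hE z).1 hz φ hφ g

theorem tensorFunctional_comp_crossToDescent (hE : E.Nondegenerate) (φ : E.functionals)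
    (ψ : Crossed α →+ Crossed α) :
    (tensorFunctional E (self (Crossed α)) (Crossed.leftMul α) φ ψ).comp (crossToDescent hE) =
      ψ.comp (crossEval α φ.1) :=
  AddMonoidHom.ext <| (tensorToCross_surjective hE).forall.2 fun t => by
    exact (congrArg (tensorFunctional E (self (Crossed α)) (Crossed.leftMul α) φ ψ)
      (crossToDescent_tensorToCross hE t)).trans (congrArg ψ (crossEval_tensorToCross φ.2 t).symm)

theorem isQuotient_crossToDescent (hE : E.Nondegenerate) :
    IsQuotient (crossToDescent (α := α) hE) where
  surjective := QuotientAddGroup.mk_surjective.forall.2 fun t =>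
    ⟨tensorToCross α E t, crossToDescent_tensorToCross hE t⟩
  map_act := (tensorToCross_surjective hE).forall.2 fun t x => by
    rw [← tensorToCross_right, crossToDescent_tensorToCross, crossToDescent_tensorToCross]
    rfl
  exists_comp_eq χ hχ := by
    let K := (descentModule α E).functionals.map
      (AddMonoidHom.compHom.flip (crossToDescent hE) :
        (descentModule α E →+ Crossed α) →+ (crossModule α E →+ Crossed α))
    suffices h : (crossModule α E).functionals ≤ K from h hχ
    exact crossModule.functionals_le fun a g φ hφ => ⟨_, AddSubgroup.subset_closure
      ⟨⟨φ, hφ⟩, ⟨_, Crossed.mk α a g, rfl⟩, rfl⟩, tensorFunctional_comp_crossToDescent hE ⟨φ, hφ⟩ _⟩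
  comp_mem χ hχ := by
    let K := (crossModule α E).functionals.comap
      (AddMonoidHom.compHom.flip (crossToDescent hE) :
        (descentModule α E →+ Crossed α) →+ (crossModule α E →+ Crossed α))
    refine (AddSubgroup.closure_le K).2 ?_ hχ
    rintro _ ⟨φ, ⟨_, c, rfl⟩, rfl⟩
    change (tensorFunctional E (self (Crossed α)) (Crossed.leftMul α) φ
      (AddMonoidHom.mulLeft c)).comp (crossToDescent hE) ∈ (crossModule α E).functionals
    rw [tensorFunctional_comp_crossToDescent]
    exact crossModule.mulLeft_comp_crossEval_mem c φ.2

variable {S : ModAction α E}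

theorem crossOp_act_single_one (T : E.compacts) (g : G) (ξ : E) (x : Crossed α) :
    crossOp S g T ((crossModule α E).act (crossSingle α 1 ξ) x) =
      (crossModule α E).act (crossSingle α 1 ((T : AddMonoid.End E) (S.S g ξ)))
        (Crossed.V α g x) := by
  induction x using Crossed.induction with
  | h0 => simp only [map_zero]
  | hadd x y hx hy => simp only [map_add, hx, hy]
  | hmk b h => rw [crossModule.act_one_mk, crossOp_single, Crossed.V_mk, crossModule.act_one_mk,
      S.S_act, compacts_apply_act]

/-- The homomorphism `σ : K(E) ⋊ G → K(E ⊗_A (A ⋊ G))`. -/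
def descentMap (S : ModAction α E) (hE : E.Nondegenerate) :
    Crossed S.Ad →ₙ+* (descentModule α E).compacts :=
  (isQuotient_crossToDescent hE).compactsMap.comp
    (crossCompactsEquiv S hE : Crossed S.Ad →ₙ+* (crossModule α E).compacts)

theorem descentMap_apply (hE : E.Nondegenerate) (x : Crossed S.Ad) (z : crossModule α E) :
    (descentMap S hE x : AddMonoid.End (descentModule α E)) (crossToDescent hE z) =
      crossToDescent hE (crossRep S x z) :=
  (isQuotient_crossToDescent hE).compactsMap_apply _ z

theorem isDescentIso_descentMap (hE : E.Nondegenerate) : IsDescentIso S (descentMap S hE) := by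
  intro T g ξ x
  rw [← crossToDescent_act_single_one hE, descentMap_apply, crossRep_mk, crossOp_act_single_one,
    crossToDescent_act_single_one]

theorem descentMap_surjective (hE : E.Nondegenerate) : Function.Surjective (descentMap S hE) :=
  (isQuotient_crossToDescent hE).compactsMap_surjective.comp (crossCompactsEquiv S hE).surjective

theorem descentMap_eq_zero_iff (hE : E.Nondegenerate) (x : Crossed S.Ad) :
    descentMap S hE x = 0 ↔
      ∀ g ξ, ∀ φ ∈ E.functionals, φ ((Crossed.coeff x g).1 ξ) = 0 := by
  have map_eq_zero_iff : descentMap S hE x = 0 ↔ ∀ z, crossToDescent hE (crossRep S x z) = 0 :=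
    (isQuotient_crossToDescent hE).compactsMap_eq_zero_iff _
  simp only [map_eq_zero_iff, crossToDescent_eq_zero_iff]
  constructor
  · intro h g ξ φ hφ
    have := h (crossSingle α 1 (S.S g⁻¹ ξ)) φ hφ (g * 1)
    rwa [coeff_crossRep_single, S.S_apply_inv] at this
  · intro h z φ hφ k
    refine crossModule.mem_of_single_mem (K := AddMonoidHom.ker
      ((φ.comp (crossCoeff k)).comp (crossRep S x))) (fun l ξ => ?_) z
    refine Eq.trans ?_ (h (k * l⁻¹) (S.S (k * l⁻¹) ξ) φ hφ)
    rw [← coeff_crossRep_single, inv_mul_cancel_right]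
    rfl

theorem descentMap_bijective (hE : E.Nondegenerate) (h : E.Separated) :
    Function.Bijective (descentMap S hE) :=
  ⟨((isQuotient_crossToDescent hE).compactsMap_injective (crossToDescent_injective hE h)).comp
    (crossCompactsEquiv S hE).injective, descentMap_surjective hE⟩

theorem cofull_descentModule (hE : E.Cofull) : (descentModule α E).Cofull :=
  (isQuotient_crossToDescent hE.nondegenerate).cofull (crossModule.cofull hE)

end descentModule

/-! ### Direct sums -/

section crossMap

open FModule

variable {α : G →* RingAut A} {E F : FModule A}

variable (α) in
/-- The map `ξ ⋊ g ↦ p(ξ) ⋊ g`. -/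
def crossMap (p : E →+ F) : crossModule α E →+ crossModule α F := Finsupp.mapRange.addMonoidHom p

theorem crossMap_single (p : E →+ F) (g : G) (ξ : E) :
    crossMap α p (crossSingle α g ξ) = crossSingle α g (p ξ) :=
  Finsupp.mapRange_single (hf := map_zero p)

theorem crossMap_act {p : E →+ F} (h : ∀ ξ a, p (E.act ξ a) = F.act (p ξ) a)
    (z : crossModule α E) (x : Crossed α) :
    crossMap α p ((crossModule α E).act z x) = (crossModule α F).act (crossMap α p z) x := by
  induction x using Crossed.induction with
  | h0 => simp only [map_zero]
  | hadd x y hx hy => simp only [map_add, hx, hy]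
  | hmk b k =>
    refine crossModule.mem_of_single_mem (K := AddMonoidHom.eqLocus
      ((crossMap α p).comp ((crossModule α E).act.flip (Crossed.mk α b k)))
      (((crossModule α F).act.flip (Crossed.mk α b k)).comp (crossMap α p))) (fun g ξ => ?_) z
    change crossMap α p ((crossModule α E).act (crossSingle α g ξ) (Crossed.mk α b k)) =
      (crossModule α F).act (crossMap α p (crossSingle α g ξ)) (Crossed.mk α b k)
    rw [crossModule.act_single_mk, crossMap_single, crossMap_single, crossModule.act_single_mk, h]

theorem crossEval_comp_crossMap (φ : F →+ A) (p : E →+ F) :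
    (crossEval α φ).comp (crossMap α p) = crossEval α (φ.comp p) :=
  (Finsupp.mapRange.addMonoidHom_comp φ p).symm

theorem comp_crossMap_mem {p : E →+ F} (h : ∀ φ ∈ F.functionals, φ.comp p ∈ E.functionals)
    {χ : crossModule α F →+ Crossed α} (hχ : χ ∈ (crossModule α F).functionals) :
    χ.comp (crossMap α p) ∈ (crossModule α E).functionals := by
  let K := (crossModule α E).functionals.comap (AddMonoidHom.compHom.flip (crossMap α p) :
    (crossModule α F →+ Crossed α) →+ (crossModule α E →+ Crossed α))
  suffices h : (crossModule α F).functionals ≤ K from h hχ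
  refine crossModule.functionals_le fun a g φ hφ => ?_
  change (AddMonoidHom.mulLeft (Crossed.mk α a g)).comp ((crossEval α φ).comp (crossMap α p)) ∈
    (crossModule α E).functionals
  rw [crossEval_comp_crossMap]
  exact crossModule.mulLeft_comp_crossEval_mem _ (h φ hφ)

theorem isQuotient_crossMap {p : E →+ F} (hp : IsQuotient p) : IsQuotient (crossMap α p) where
  surjective := Finsupp.mapRange_surjective p (map_zero p) hp.surjective
  map_act := crossMap_act hp.map_act
  exists_comp_eq χ hχ := by
    let K := (crossModule α F).functionals.map (AddMonoidHom.compHom.flip (crossMap α p) :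
      (crossModule α F →+ Crossed α) →+ (crossModule α E →+ Crossed α))
    suffices h : (crossModule α E).functionals ≤ K from h hχ
    refine crossModule.functionals_le fun a g ψ hψ => ?_
    obtain ⟨φ, hφ, rfl⟩ := hp.exists_comp_eq ψ hψ
    exact ⟨_, crossModule.mulLeft_comp_crossEval_mem (Crossed.mk α a g) hφ,
      congrArg (AddMonoidHom.comp _) (crossEval_comp_crossMap φ p)⟩
  comp_mem _ := comp_crossMap_mem hp.comp_mem

theorem crossMap_injective {p : E →+ F} (hp : Function.Injective p) :
    Function.Injective (crossMap α p) :=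
  Finsupp.mapRange_injective p (map_zero p) hp

variable (α E F) in
/-- The map `(ξ, η) ⋊ g ↦ (ξ ⋊ g, η ⋊ g)`. -/
def crossProd : crossModule α (E.prod F) →+ (crossModule α E).prod (crossModule α F) :=
  (crossMap α (E := E.prod F) (AddMonoidHom.fst E F)).prod
    (crossMap α (E := E.prod F) (AddMonoidHom.snd E F))

theorem crossProd_single (g : G) (ξ : E.prod F) :
    crossProd α E F (crossSingle α g ξ) = (crossSingle α g ξ.1, crossSingle α g ξ.2) :=
  Prod.ext (crossMap_single _ g ξ) (crossMap_single _ g ξ)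

theorem crossProd_injective : Function.Injective (crossProd α E F) := fun _ _ h =>
  crossModule.ext fun g => Prod.ext
    (congrArg (fun w : crossModule α E × crossModule α F => crossCoeff g w.1) h)
    (congrArg (fun w : crossModule α E × crossModule α F => crossCoeff g w.2) h)

theorem crossEval_coprod (φ : E →+ A) (ψ : F →+ A) (z : crossModule α (E.prod F)) :
    crossEval (E := E.prod F) α (φ.coprod ψ) z =
      crossEval α φ (crossProd α E F z).1 + crossEval α ψ (crossProd α E F z).2 :=
  Crossed.ext fun _ => rfl

theorem isQuotient_crossProd : IsQuotient (crossProd α E F) where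
  surjective := by
    rintro ⟨z, w⟩
    refine ⟨crossMap α (F := E.prod F) (AddMonoidHom.inl E F) z +
      crossMap α (F := E.prod F) (AddMonoidHom.inr E F) w, ?_⟩
    refine Prod.ext (crossModule.ext fun g => ?_) (crossModule.ext fun g => ?_)
    · exact add_zero (crossCoeff g z)
    · exact zero_add (crossCoeff g w)
  map_act z x := Prod.ext (crossMap_act (E := E.prod F) (fun _ _ => rfl) z x)
    (crossMap_act (E := E.prod F) (fun _ _ => rfl) z x)
  exists_comp_eq χ hχ := by
    let K := ((crossModule α E).prod (crossModule α F)).functionals.map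
      (AddMonoidHom.compHom.flip (crossProd α E F) :
      (((crossModule α E).prod (crossModule α F)) →+ Crossed α) →+
        (crossModule α (E.prod F) →+ Crossed α))
    suffices h : (crossModule α (E.prod F)).functionals ≤ K from h hχ
    refine crossModule.functionals_le ?_
    rintro a g _ ⟨φ, hφ, ψ, hψ, rfl⟩
    refine ⟨_, ⟨_, crossModule.mulLeft_comp_crossEval_mem (Crossed.mk α a g) hφ,
      _, crossModule.mulLeft_comp_crossEval_mem (Crossed.mk α a g) hψ, rfl⟩, ?_⟩
    exact AddMonoidHom.ext fun z =>
      (mul_add _ _ _).symm.trans (congrArg _ (crossEval_coprod φ ψ z).symm)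
  comp_mem := by
    rintro _ ⟨χ, hχ, χ', hχ', rfl⟩
    have hfst := comp_crossMap_mem (E := E.prod F) (p := AddMonoidHom.fst E F)
      (fun φ hφ => ⟨φ, hφ, 0, zero_mem _, AddMonoidHom.ext fun ξ => (add_zero (φ ξ.1)).symm⟩) hχ
    have hsnd := comp_crossMap_mem (E := E.prod F) (p := AddMonoidHom.snd E F)
      (fun φ hφ => ⟨0, zero_mem _, φ, hφ, AddMonoidHom.ext fun ξ => (zero_add (φ ξ.2)).symm⟩) hχ'
    have hsum : χ.comp (crossMap α (AddMonoidHom.fst E F)) +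
        χ'.comp (crossMap α (AddMonoidHom.snd E F)) = (χ.coprod χ').comp (crossProd α E F) :=
      AddMonoidHom.ext fun _ => rfl
    exact hsum ▸ add_mem hfst hsnd

end crossMap

theorem Crossed.mem_of_mul_mk_one_mem {α : G →* RingAut A} (hA : IsQuadratik A)
    {K : AddSubgroup (Crossed α)} (h : ∀ x b, x * mk α b 1 ∈ K) (x : Crossed α) : x ∈ K := by
  refine mem_of_mk_mem (fun a g => ?_) x
  refine hA.mem_of_mul_mem (K := K.comap (mkHom α g)) (fun b c => ?_) a
  have hmul : mk α b g * mk α ((α g).symm c) 1 = mk α (b * c) g := by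
    rw [mk_mul_mk, mul_one, RingEquiv.apply_symm_apply]
  change mk α (b * c) g ∈ K
  exact hmul ▸ h _ _

section crossCopies

open FModule

variable (α : G →* RingAut A) (I : Type u)

/-- The map `(⨁ A) ⋊ G → ⨁ (A ⋊ G)`, `(a_i)_i ⋊ g ↦ (a_i ⋊ g)_i`. -/
def crossCopies : crossModule α (copies A I) →+ copies (Crossed α) I :=
  Finsupp.liftAddHom (M := I →₀ A) fun g => Finsupp.mapRange.addMonoidHom (Crossed.mkHom α g)

variable {α I}

theorem crossCopies_single (g : G) (η : copies A I) : crossCopies α I (crossSingle α g η) =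
    Finsupp.mapRange.addMonoidHom (Crossed.mkHom α g) η :=
  Finsupp.liftAddHom_apply_single _ _ _

theorem crossCopies_single_single (i : I) (g : G) (a : A) :
    crossCopies α I (crossSingle α g (single i a)) = single i (Crossed.mk α a g) :=
  (crossCopies_single g _).trans (Finsupp.mapRange_single (hf := map_zero (Crossed.mkHom α g)))

theorem coord_crossCopies (i : I) (z : crossModule α (copies A I)) :
    coord i (crossCopies α I z) = crossEval α (coord i) z := by
  refine crossModule.mem_of_single_mem (K := AddMonoidHom.eqLocus
    ((coord i).comp (crossCopies α I)) (crossEval α (coord i))) (fun g η => ?_) z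
  exact (congrArg (coord i) (crossCopies_single g η)).trans (crossEval_single (coord i) g η).symm

theorem coord_crossCopies_single (i : I) (g : G) (η : copies A I) :
    coord i (crossCopies α I (crossSingle α g η)) = Crossed.mk α (coord i η) g :=
  (coord_crossCopies i _).trans (crossEval_single (coord i) g η)

theorem crossCopies_injective : Function.Injective (crossCopies α I) := fun z w h =>
  crossModule.ext fun g => copies_ext fun i => by
    have hi := (coord_crossCopies i z).symm.trans ((congrArg (coord i) h).trans
      (coord_crossCopies i w))
    exact congrArg (Crossed.coeff · g) hi

theorem copies_hom_ext {N : Type u} [AddCommGroup N] {f f' : copies A I →+ N}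
    (h : ∀ i a, f (single i a) = f' (single i a)) : f = f' :=
  Finsupp.addHom_ext h

theorem rowFunctional_single_right (c : I → A) (i : I) (a : A) :
    rowFunctional A I c (single i a) = c i * a :=
  Finsupp.liftAddHom_apply_single _ _ _

theorem rowFunctional_comp_crossCopies (x : Crossed α) (c : I → A) :
    (rowFunctional (Crossed α) I fun i => x * Crossed.mk α (c i) 1).comp (crossCopies α I) =
      (AddMonoidHom.mulLeft x).comp (crossEval α (rowFunctional A I c)) := by
  let f : crossModule α (copies A I) →+ Crossed α :=
    (rowFunctional (Crossed α) I fun i => x * Crossed.mk α (c i) 1).comp (crossCopies α I)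
  let f' : crossModule α (copies A I) →+ Crossed α :=
    (AddMonoidHom.mulLeft x).comp (crossEval α (rowFunctional A I c))
  suffices h : ∀ g, f.comp (crossSingle α g) = f'.comp (crossSingle α g) from
    crossModule.hom_ext fun g => DFunLike.congr_fun (h g)
  refine fun g => copies_hom_ext fun i a => ?_
  have hf' : f' (crossSingle α g (single i a)) = x * Crossed.mk α (c i * a) g :=
    congrArg (x * ·) ((crossEval_single (E := copies A I) _ g _).trans
      (congrArg (Crossed.mk α · g) (rowFunctional_single_right c i a)))
  refine Eq.trans ?_ hf'.symm
  change rowFunctional (Crossed α) I (fun i => x * Crossed.mk α (c i) 1)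
    (crossCopies α I (crossSingle α g (single i a))) = _
  rw [crossCopies_single_single, rowFunctional_single_right, mul_assoc, Crossed.mk_mul_mk, map_one,
    RingAut.one_apply, one_mul]

theorem isCovering_crossCopies : IsCovering (crossCopies α I) where
  surjective w := by
    refine Finsupp.induction_linear (motive := fun w => ∃ z, crossCopies α I z = w) w
      ⟨0, map_zero _⟩ ?_ fun i x => ?_
    · rintro _ _ ⟨z, rfl⟩ ⟨z', rfl⟩
      exact ⟨z + z', map_add _ _ _⟩
    · exact Crossed.mem_of_mk_mem (K := (crossCopies α I).range.comap (single i))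
        (fun a g => ⟨_, crossCopies_single_single i g a⟩) x
  map_act z x := copies_ext fun i => by
    rw [coord_act, coord_crossCopies, coord_crossCopies]
    exact crossEval_act (coord_act · · i) z x
  exists_comp_eq χ hχ := by
    let K := (copies (Crossed α) I).functionals.map (AddMonoidHom.compHom.flip (crossCopies α I) :
      (copies (Crossed α) I →+ Crossed α) →+ (crossModule α (copies A I) →+ Crossed α))
    suffices h : (crossModule α (copies A I)).functionals ≤ K from h hχ
    refine crossModule.functionals_le ?_
    rintro a g _ ⟨c, rfl⟩
    exact ⟨_, ⟨_, rfl⟩, rowFunctional_comp_crossCopies _ c⟩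

theorem isQuotient_crossCopies (hA : IsQuadratik A) [Finite I] :
    IsQuotient (crossCopies α I) where
  __ := isCovering_crossCopies
  comp_mem := by
    classical
    rintro _ ⟨c, rfl⟩
    have := Fintype.ofFinite I
    let K : AddSubgroup (I → Crossed α) := (crossModule α (copies A I)).functionals.comap
      ((AddMonoidHom.compHom.flip (crossCopies α I)).comp (rowFunctional (Crossed α) I))
    suffices h : ∀ i x, Pi.single i x ∈ K by
      rw [← Finset.univ_sum_single c]
      exact AddSubgroup.sum_mem K fun i _ => h i (c i)
    refine fun i x => Crossed.mem_of_mul_mk_one_mem hA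
      (K := K.comap (AddMonoidHom.single (fun _ => Crossed α) i)) (fun x b => ?_) x
    have hsingle : (Pi.single i (x * Crossed.mk α b 1) : I → Crossed α) =
        fun k => x * Crossed.mk α ((Pi.single i b : I → A) k) 1 :=
      funext fun k => (Pi.apply_single (fun _ => (AddMonoidHom.mulLeft x).comp (Crossed.mkHom α 1))
        (fun _ => map_zero _) i b k).symm
    change (rowFunctional (Crossed α) I (Pi.single i (x * Crossed.mk α b 1))).comp
      (crossCopies α I) ∈ (crossModule α (copies A I)).functionals
    rw [hsingle, rowFunctional_comp_crossCopies]
    exact crossModule.mulLeft_comp_crossEval_mem x ⟨_, rfl⟩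

end crossCopies

section crossProdMap

open FModule

variable {α : G →* RingAut A} {E : FModule A} {N : FModule (Crossed α)} {I : Type u}

variable (I) in
/-- The map `(ξ, (a_i)_i) ⋊ g ↦ (q(ξ ⋊ g), (a_i ⋊ g)_i)`. -/
def crossProdMap (q : crossModule α E →+ N) :
    crossModule α (E.prod (copies A I)) →+ N.prod (copies (Crossed α) I) :=
  (AddMonoidHom.prodMap q (crossCopies α I)).comp (crossProd α E (copies A I))

theorem crossProdMap_single (q : crossModule α E →+ N) (g : G) (ζ : E.prod (copies A I)) :
    crossProdMap I q (crossSingle α g ζ) =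
      (q (crossSingle α g ζ.1), crossCopies α I (crossSingle α g ζ.2)) :=
  congrArg (AddMonoidHom.prodMap q (crossCopies α I)) (crossProd_single g ζ)

theorem crossProdMap_injective {q : crossModule α E →+ N} (hq : Function.Injective q) :
    Function.Injective (crossProdMap I q) :=
  (hq.prodMap crossCopies_injective).comp crossProd_injective

theorem isCovering_crossProdMap {q : crossModule α E →+ N} (hq : IsCovering q) :
    IsCovering (crossProdMap I q) :=
  (hq.prodMap isCovering_crossCopies).comp isQuotient_crossProd.toIsCovering

theorem isQuotient_crossProdMap (hA : IsQuadratik A) [Finite I] {q : crossModule α E →+ N}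
    (hq : IsQuotient q) : IsQuotient (crossProdMap I q) :=
  (hq.prodMap (isQuotient_crossCopies hA)).comp isQuotient_crossProd

theorem coord_crossProdMap_single (q : crossModule α E →+ N) (i : I) (g : G)
    (ζ : E.prod (copies A I)) :
    coord i (crossProdMap I q (crossSingle α g ζ)).2 = Crossed.mk α (coord i ζ.2) g := by
  rw [crossProdMap_single, coord_crossCopies_single]

theorem crossProdMap_single_single (q : crossModule α E →+ N) (i : I) (g : G) (a : A) :
    crossProdMap I q (crossSingle α g ((0, single i a) : E.prod (copies A I))) =
      (0, single i (Crossed.mk α a g)) :=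
  (crossProdMap_single q g _).trans <| Prod.ext
    ((congrArg q (map_zero (crossSingle α g))).trans (map_zero q))
    (crossCopies_single_single i g a)

end crossProdMap

section cornerHom

open FModule

variable {α : G →* RingAut A} {E : FModule A} {N : FModule (Crossed α)} {I J : Type u}

theorem map_crossRep_cornerHom (hA : IsQuadratik A) (S : ModAction α E) {i : I}
    {U : ModAction α (copies A I)} (hU : U.IsDistinguished i) {j : J}
    {Y : crossModule α (E.prod (copies A I)) →+ N.prod (copies (Crossed α) J)}
    (hcoord : ∀ g ζ, coord j (Y (crossSingle α g ζ)).2 = Crossed.mk α (coord i ζ.2) g)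
    (hsingle : ∀ g a, Y (crossSingle α g ((0, single i a) : E.prod (copies A I))) =
      (0, single j (Crossed.mk α a g)))
    (x : Crossed α) (z : crossModule α (E.prod (copies A I))) :
    Y (crossRep (S.prod U)
        (Crossed.map (cornerHom hA E I i) (cornerHom_equivariant hA S U hU) x) z) =
      (cornerHom (Crossed.quadratik α hA) N J j x : AddMonoid.End _) (Y z) := by
  induction x using Crossed.induction with
  | h0 =>
    rw [map_zero, map_zero, map_zero]
    exact map_zero Y
  | hadd x y hx hy =>
    rw [map_add, map_add, map_add]
    exact (map_add Y _ _).trans (congrArg₂ (· + ·) hx hy)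
  | hmk a g =>
    rw [Crossed.map_mk, crossRep_mk]
    refine crossModule.mem_of_single_mem (K := AddMonoidHom.eqLocus
      (Y.comp (crossOp (S.prod U) g (cornerHom hA E I i a).1))
      (AddMonoidHom.comp (cornerOp N J j (Crossed.mk α a g)) Y)) (fun h ζ => ?_) z
    change Y (crossOp (S.prod U) g (cornerHom hA E I i a).1 (crossSingle α h ζ)) =
      (0, single j (Crossed.mk α a g * coord j (Y (crossSingle α h ζ)).2))
    rw [crossOp_single, hcoord, Crossed.mk_mul_mk, ← hU.coord_S]
    exact hsingle _ _

theorem cornerHom_injective_iff (hA : IsQuadratik A) (i : I) :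
    Function.Injective (cornerHom hA E I i) ↔ ∀ a : A, (∀ b, a * b = 0) → a = 0 := by
  refine (injective_iff_map_eq_zero _).trans (forall_congr' fun a => imp_congr_left ⟨fun h b => ?_,
    fun h => Subtype.ext <| AddMonoidHom.ext fun ζ => Prod.ext rfl ?_⟩)
  · have hζ := congrArg (fun T : (E.prod (copies A I)).compacts => coord i
      ((T : AddMonoid.End (E.prod (copies A I))) ((0, single i b) : E × copies A I)).2) h
    change coord i (single i (a * coord i (single i b))) = 0 at hζ
    rwa [coord_single_same, coord_single_same] at hζ
  · change single i (a * coord i ζ.2) = 0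
    rw [h, map_zero]

theorem Crossed.coeff_mul_mk_one (x : Crossed α) (b : A) (g : G) :
    coeff (x * mk α b 1) g = coeff x g * α g b := by
  refine mem_of_mk_mem (K := AddMonoidHom.eqLocus
    ((Finsupp.applyAddHom g : (G →₀ A) →+ A).comp (AddMonoidHom.mulRight (mk α b 1)))
    ((AddMonoidHom.mulRight (α g b)).comp (Finsupp.applyAddHom g : (G →₀ A) →+ A)))
    (fun a h => ?_) x
  change coeff (mk α a h * mk α b 1) g = coeff (mk α a h) g * α g b
  rw [mk_mul_mk, mul_one]
  obtain rfl | hgh := eq_or_ne g h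
  · rw [coeff_mk_same, coeff_mk_same]
  · rw [coeff_mk_of_ne hgh, coeff_mk_of_ne hgh, zero_mul]

theorem cornerHom_crossed_injective (hA : IsQuadratik A) (i : I)
    (h : Function.Injective (cornerHom hA E I i)) :
    Function.Injective (cornerHom (Crossed.quadratik α hA) N I i) := by
  rw [cornerHom_injective_iff] at h ⊢
  refine fun x hx => Crossed.ext fun g => h _ fun b => ?_
  rw [← (α g).apply_symm_apply b, ← Crossed.coeff_mul_mk_one, hx]
  rfl

end cornerHom

section descentProd

open FModule

variable {α : G →* RingAut A} {E : FModule A} {I : Type u}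

variable (I) in
/-- The map `(ξ, (a_i)_i) ⋊ g ↦ (ξ ⊗ (1 ⋊ g), (a_i ⋊ g)_i)`. -/
def crossToDescentProd (hE : E.Nondegenerate) : crossModule α (E.prod (copies A I)) →+
    (descentModule α E).prod (copies (Crossed α) I) :=
  crossProdMap I (crossToDescent hE)

variable (hE : (E.prod (copies A I)).Nondegenerate)

theorem isCovering_crossToDescentProd : IsCovering (crossToDescentProd (α := α) I hE.fst) :=
  isCovering_crossProdMap (isQuotient_crossToDescent hE.fst).toIsCovering

theorem crossToDescentProd_injective (hsep : (E.prod (copies A I)).Separated) :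
    Function.Injective (crossToDescentProd (α := α) I hE.fst) :=
  crossProdMap_injective (crossToDescent_injective hE.fst hsep.fst)

variable (hsep : (E.prod (copies A I)).Separated)

variable (α) in
/-- The canonical bijection `(E ⊕ ⨁ A) ⊗ (A ⋊ G) ≅ (E ⊗ (A ⋊ G)) ⊕ ⨁ (A ⋊ G)`. -/
def descentProdEquiv : descentModule α (E.prod (copies A I)) ≃+
    (descentModule α E).prod (copies (Crossed α) I) :=
  (AddEquiv.ofBijective (crossToDescent hE)
    ⟨crossToDescent_injective hE hsep, (isQuotient_crossToDescent hE).surjective⟩).symm.trans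
  (AddEquiv.ofBijective (crossToDescentProd I hE.fst)
    ⟨crossToDescentProd_injective hE hsep, (isCovering_crossToDescentProd hE).surjective⟩)

theorem descentProdEquiv_crossToDescent (z : crossModule α (E.prod (copies A I))) :
    descentProdEquiv α hE hsep (crossToDescent hE z) = crossToDescentProd I hE.fst z :=
  congrArg (crossToDescentProd I hE.fst) (AddEquiv.symm_apply_apply (AddEquiv.ofBijective _ _) z)

theorem descentProdEquiv_comp_crossToDescent :
    (descentProdEquiv α hE hsep : descentModule α (E.prod (copies A I)) →+
      (descentModule α E).prod (copies (Crossed α) I)).comp (crossToDescent hE) =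
        crossToDescentProd I hE.fst :=
  AddMonoidHom.ext (descentProdEquiv_crossToDescent hE hsep)

theorem isCovering_descentProdEquiv :
    IsCovering (descentProdEquiv α hE hsep : descentModule α (E.prod (copies A I)) →+
      (descentModule α E).prod (copies (Crossed α) I)) :=
  (isQuotient_crossToDescent hE).isCovering_of_comp <| by
    rw [descentProdEquiv_comp_crossToDescent]
    exact isCovering_crossToDescentProd hE

theorem isQuotient_descentProdEquiv (hA : IsQuadratik A) [Finite I] :
    IsQuotient (descentProdEquiv α hE hsep : descentModule α (E.prod (copies A I)) →+
      (descentModule α E).prod (copies (Crossed α) I)) :=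
  IsQuotient.of_comp (isQuotient_crossToDescent hE) <| by
    rw [descentProdEquiv_comp_crossToDescent]
    exact isQuotient_crossProdMap hA (isQuotient_crossToDescent hE.fst)

theorem descentProdEquiv_tmul (ζ : E.prod (copies A I)) (x : Crossed α) :
    descentProdEquiv α hE hsep (descentTmul α (E.prod (copies A I)) ζ x) =
      ((descentModule α E).prod (copies (Crossed α) I)).act
        (crossToDescentProd I hE.fst (crossSingle α 1 ζ)) x := by
  rw [← crossToDescent_act_single_one hE, descentProdEquiv_crossToDescent]
  exact (isCovering_crossToDescentProd hE).map_act _ x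

theorem descentProdEquiv_tmul_fst (ζ : E.prod (copies A I)) (x : Crossed α) :
    (descentProdEquiv α hE hsep (descentTmul α (E.prod (copies A I)) ζ x)).1 =
      descentTmul α E ζ.1 x := by
  rw [descentProdEquiv_tmul, crossToDescentProd, crossProdMap_single,
    ← crossToDescent_act_single_one hE.fst]
  exact ((isQuotient_crossToDescent hE.fst).map_act _ x).symm

theorem coord_descentProdEquiv_tmul (ζ : E.prod (copies A I)) (x : Crossed α) (i : I) :
    coord i (descentProdEquiv α hE hsep (descentTmul α (E.prod (copies A I)) ζ x)).2 =
      Crossed.mk α (coord i ζ.2) 1 * x := by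
  rw [descentProdEquiv_tmul, ← coord_crossProdMap_single (crossToDescent hE.fst)]
  rfl

theorem compactsMap_descentMap_cornerHom (hA : IsQuadratik A) (S : ModAction α E) {i : I}
    {U : ModAction α (copies A I)} (hU : U.IsDistinguished i) (x : Crossed α) :
    (isCovering_descentProdEquiv hE hsep).compactsMap (descentMap (S.prod U) hE
        (Crossed.map (cornerHom hA E I i) (cornerHom_equivariant hA S U hU) x)) =
      cornerHom (Crossed.quadratik α hA) (descentModule α E) I i x := by
  refine (isCovering_crossToDescentProd hE).compacts_ext fun z => ?_
  rw [← descentProdEquiv_crossToDescent hE hsep]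
  refine ((isCovering_descentProdEquiv hE hsep).compactsMap_apply _ _).trans ?_
  rw [descentMap_apply]
  refine (descentProdEquiv_crossToDescent hE hsep _).trans ?_
  rw [descentProdEquiv_crossToDescent]
  exact map_crossRep_cornerHom hA S hU (coord_crossProdMap_single _ i)
    (crossProdMap_single_single _ i) x z

end descentProd

/-! ### Corner embeddings -/

section splitCoord

open FModule

variable (E F D : FModule A)

/-- The associativity map `E ⊕ (F ⊕ D) → (E ⊕ F) ⊕ D`. -/
def prodAssoc : E.prod (F.prod D) →+ (E.prod F).prod D :=
  (AddEquiv.prodAssoc (M := E) (N := F) (P := D)).symm.toAddMonoidHom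

theorem prodAssoc_injective : Function.Injective (prodAssoc E F D) :=
  (AddEquiv.prodAssoc (M := E) (N := F) (P := D)).symm.injective

theorem isQuotient_prodAssoc : IsQuotient (prodAssoc E F D) where
  surjective := (AddEquiv.prodAssoc (M := E) (N := F) (P := D)).symm.surjective
  map_act _ _ := rfl
  exists_comp_eq := by
    rintro _ ⟨φ, hφ, _, ⟨ψ, hψ, χ, hχ, rfl⟩, rfl⟩
    exact ⟨_, ⟨_, ⟨φ, hφ, ψ, hψ, rfl⟩, χ, hχ, rfl⟩, AddMonoidHom.ext fun _ => add_assoc _ _ _⟩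
  comp_mem := by
    rintro _ ⟨_, ⟨φ, hφ, ψ, hψ, rfl⟩, χ, hχ, rfl⟩
    exact ⟨φ, hφ, _, ⟨ψ, hψ, χ, hχ, rfl⟩, AddMonoidHom.ext fun _ => add_assoc _ _ _⟩

variable {I : Type u} (i₀ : I)

variable (A) in
/-- The map `(a_i)_i ↦ ((a_i)_{i ≠ i₀}, a_{i₀})`. -/
def splitCoord : copies A I →+ (copies A {i // i ≠ i₀}).prod (copies A PUnit.{u + 1}) :=
  AddMonoidHom.prod (Finsupp.subtypeDomainAddMonoidHom : (I →₀ A) →+ ({i // i ≠ i₀} →₀ A))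
    ((single PUnit.unit).comp (coord i₀))

variable {i₀}

theorem coord_splitCoord_fst (i : {i // i ≠ i₀}) (η : copies A I) :
    coord i (splitCoord A i₀ η).1 = coord i.1 η := rfl

theorem splitCoord_single_same (a : A) :
    splitCoord A i₀ (single i₀ a) = (0, single PUnit.unit a) :=
  Prod.ext (copies_ext fun i => coord_single_of_ne i.2 a)
    (congrArg (single PUnit.unit) (coord_single_same i₀ a))

theorem splitCoord_single_of_ne (i : {i // i ≠ i₀}) (a : A) :
    splitCoord A i₀ (single i.1 a) = (single i a, 0) :=
  Prod.ext (copies_ext fun k => by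
      rw [coord_splitCoord_fst]
      obtain rfl | h := eq_or_ne k i
      · rw [coord_single_same, coord_single_same]
      · rw [coord_single_of_ne h, coord_single_of_ne (Subtype.coe_ne_coe.2 h)])
    ((congrArg (single PUnit.unit) (coord_single_of_ne i.2.symm a)).trans (map_zero _))

theorem splitCoord_injective : Function.Injective (splitCoord A i₀) := fun η η' h =>
  copies_ext fun i => by
    by_cases hi : i = i₀
    · have h₂ := congrArg (fun w => coord PUnit.unit w.2) h
      change coord PUnit.unit (single PUnit.unit (coord i₀ η)) =
        coord PUnit.unit (single PUnit.unit (coord i₀ η')) at h₂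
      rwa [coord_single_same, coord_single_same, ← hi] at h₂
    · exact congrArg (fun w => coord ⟨i, hi⟩ w.1) h

theorem coprod_rowFunctional_comp_splitCoord (c : I → A) :
    AddMonoidHom.comp (AddMonoidHom.coprod (rowFunctional A {i // i ≠ i₀} fun i => c i)
      (rowFunctional A PUnit fun _ => c i₀)) (splitCoord A i₀) = rowFunctional A I c := by
  refine copies_hom_ext fun i a => Eq.trans ?_ (rowFunctional_single_right c i a).symm
  by_cases hi : i = i₀
  · subst hi
    refine (congrArg (AddMonoidHom.coprod (rowFunctional A {k // k ≠ i} fun k => c k)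
      (rowFunctional A PUnit fun _ => c i)) (splitCoord_single_same a)).trans ?_
    change rowFunctional A {k // k ≠ i} (fun k => c k) 0 +
      rowFunctional A PUnit (fun _ => c i) (single PUnit.unit a) = _
    rw [map_zero, zero_add, rowFunctional_single_right]
  · refine (congrArg (AddMonoidHom.coprod (rowFunctional A {k // k ≠ i₀} fun k => c k)
      (rowFunctional A PUnit fun _ => c i₀)) (splitCoord_single_of_ne ⟨i, hi⟩ a)).trans ?_
    change rowFunctional A {k // k ≠ i₀} (fun k => c k) (single ⟨i, hi⟩ a) +
      rowFunctional A PUnit (fun _ => c i₀) 0 = _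
    rw [map_zero, add_zero, rowFunctional_single_right]

theorem isQuotient_splitCoord : IsQuotient (splitCoord A i₀) where
  surjective := by
    classical
    rintro ⟨ζ, ω⟩
    obtain ⟨η, rfl⟩ : ∃ η, (splitCoord A i₀ η).1 = ζ :=
      ⟨Finsupp.extendDomain (P := (· ≠ i₀)) (M := A) ζ,
        Finsupp.subtypeDomain_extendDomain (M := A) ζ⟩
    refine ⟨η + single i₀ (coord PUnit.unit ω - coord i₀ η), ?_⟩
    rw [map_add, splitCoord_single_same]
    refine Prod.ext (add_zero _) (copies_ext fun _ => ?_)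
    change coord PUnit.unit (single PUnit.unit (coord i₀ η) + single PUnit.unit _) = _
    rw [map_add, coord_single_same, coord_single_same]
    exact add_sub_cancel _ _
  map_act η a := Prod.ext (copies_ext fun _ => rfl) (copies_ext fun _ => by
    change coord PUnit.unit (single PUnit.unit (coord i₀ η * a)) =
      coord PUnit.unit (single PUnit.unit (coord i₀ η)) * a
    rw [coord_single_same, coord_single_same])
  exists_comp_eq := by
    rintro _ ⟨c, rfl⟩
    exact ⟨_, ⟨_, ⟨_, rfl⟩, _, ⟨_, rfl⟩, rfl⟩, coprod_rowFunctional_comp_splitCoord c⟩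
  comp_mem := by
    classical
    rintro _ ⟨_, ⟨d, rfl⟩, _, ⟨e, rfl⟩, rfl⟩
    let c : I → A := fun i => if h : i ≠ i₀ then d ⟨i, h⟩ else e PUnit.unit
    have hd : d = fun i : {i // i ≠ i₀} => c i := funext fun i => by simp only [c, dif_pos i.2]
    have he : e = fun _ : PUnit => c i₀ := funext fun _ => by
      simp only [c, dif_neg (not_not.2 (rfl : i₀ = i₀))]
    rw [hd, he]
    exact ⟨c, (coprod_rowFunctional_comp_splitCoord c).symm⟩

variable (i₀) in
/-- The map `(ξ, (a_i)_i) ↦ ((ξ, (a_i)_{i ≠ i₀}), a_{i₀})`. -/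
def prodSplitCoord :
    E.prod (copies A I) →+ (E.prod (copies A {i // i ≠ i₀})).prod (copies A PUnit.{u + 1}) :=
  (prodAssoc E (copies A {i // i ≠ i₀}) (copies A PUnit)).comp
    (AddMonoidHom.prodMap (AddMonoidHom.id E) (splitCoord A i₀))

theorem isQuotient_prodSplitCoord : IsQuotient (prodSplitCoord E i₀) :=
  (isQuotient_prodAssoc _ _ _).comp ((IsQuotient.id E).prodMap isQuotient_splitCoord)

theorem prodSplitCoord_injective : Function.Injective (prodSplitCoord E i₀) :=
  (prodAssoc_injective _ _ _).comp (Function.injective_id.prodMap splitCoord_injective)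

theorem coord_prodSplitCoord (ζ : E.prod (copies A I)) :
    coord PUnit.unit (prodSplitCoord E i₀ ζ).2 = coord i₀ ζ.2 :=
  coord_single_same PUnit.unit _

theorem prodSplitCoord_single (a : A) :
    prodSplitCoord E i₀ ((0, single i₀ a) : E.prod (copies A I)) = (0, single PUnit.unit a) :=
  congrArg (fun w => prodAssoc E _ _ ((0, w) : E × ((copies A _).prod (copies A PUnit))))
    (splitCoord_single_same a)

end splitCoord

section IsCorner

open FModule

variable {α : G →* RingAut A} {E : FModule A} {I : Type u} {i : I}

variable (α E i) in
/-- The map `(ξ, (a_k)_k) ⋊ g ↦ ((ξ, (a_k)_{k ≠ i}) ⋊ g, a_i ⋊ g)`. -/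
def crossSplitCoord : crossModule α (E.prod (copies A I)) →+
    (crossModule α (E.prod (copies A {k // k ≠ i}))).prod (copies (Crossed α) PUnit.{u + 1}) :=
  (crossProdMap PUnit (AddMonoidHom.id _)).comp (crossMap α (prodSplitCoord E i))

theorem isQuotient_crossSplitCoord (hA : IsQuadratik A) : IsQuotient (crossSplitCoord α E i) :=
  (isQuotient_crossProdMap hA (IsQuotient.id _)).comp
    (isQuotient_crossMap (isQuotient_prodSplitCoord E))

theorem crossSplitCoord_injective : Function.Injective (crossSplitCoord α E i) :=
  (crossProdMap_injective Function.injective_id).comp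
    (crossMap_injective (prodSplitCoord_injective E))

theorem coord_crossSplitCoord_single (g : G) (ζ : E.prod (copies A I)) :
    coord PUnit.unit (crossSplitCoord α E i (crossSingle α g ζ)).2 =
      Crossed.mk α (coord i ζ.2) g := by
  refine (congrArg (fun w => coord PUnit.unit (crossProdMap PUnit (AddMonoidHom.id _) w).2)
    (crossMap_single _ g ζ)).trans ?_
  exact (coord_crossProdMap_single _ _ g _).trans
    (congrArg (Crossed.mk α · g) (coord_prodSplitCoord E ζ))

theorem crossSplitCoord_single_single (g : G) (a : A) :
    crossSplitCoord α E i (crossSingle α g ((0, single i a) : E.prod (copies A I))) =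
      (0, single PUnit.unit (Crossed.mk α a g)) := by
  refine (congrArg (crossProdMap PUnit (AddMonoidHom.id _)) ((crossMap_single _ g _).trans
    (congrArg (crossSingle α g) (prodSplitCoord_single E a)))).trans ?_
  exact crossProdMap_single_single _ _ g a

theorem Crossed.map_map {B C : Type u} [NonUnitalRing B] [NonUnitalRing C] {β : G →* RingAut B}
    {γ : G →* RingAut C} {π : A →ₙ+* B} {ρ : B →ₙ+* C} {τ : A →ₙ+* C}
    (hπ : ∀ g a, π (α g a) = β g (π a)) (hρ : ∀ g b, ρ (β g b) = γ g (ρ b))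
    (hτ : ∀ g a, τ (α g a) = γ g (τ a)) (h : ∀ a, ρ (π a) = τ a) (x : Crossed α) :
    map ρ hρ (map π hπ x) = map τ hτ x :=
  Crossed.ext fun g => by rw [coeff_map, coeff_map, coeff_map, h]

/-- The isomorphism of crossed products induced by an equivariant isomorphism. -/
def Crossed.mapEquiv {B : Type u} [NonUnitalRing B] {β : G →* RingAut B} (κ : A ≃+* B)
    (hκ : ∀ g a, κ (α g a) = β g (κ a)) : Crossed α ≃+* Crossed β :=
  RingEquiv.ofBijective (map (κ : A →ₙ+* B) hκ) ⟨map_injective _ hκ κ.injective,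
    mem_of_mk_mem (K := (map (κ : A →ₙ+* B) hκ).toAddMonoidHom.range) fun b g =>
      ⟨mk α (κ.symm b) g, (map_mk _ hκ _ g).trans (congrArg (mk β · g) (κ.apply_symm_apply b))⟩⟩

/-- The trivial action of the trivial group on a functional module. -/
def ModAction.trivial (E : FModule A) : ModAction (1 : PUnit.{u + 1} →* RingAut A) E where
  S := 1
  S_act _ _ _ := rfl
  invariant _ _ hφ := hφ

theorem isCorner_descHom {B K : QRing G} {e : EHom B K} (he : IsCorner e) :
    IsCorner (descHom e) := by
  obtain ⟨E, S, I, i, U, hU, hE, κ, hκ, hκe⟩ := he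
  have hsplit := isQuotient_crossSplitCoord (α := B.action) (E := E) (i := i) B.quadratik
  let κ' := ((Crossed.mapEquiv κ hκ).trans (crossCompactsEquiv (S.prod U) hE.nondegenerate)).trans
    (hsplit.compactsEquiv crossSplitCoord_injective)
  refine ⟨crossModule B.action (E.prod (copies B {k // k ≠ i})), ModAction.trivial _, PUnit,
    PUnit.unit, ModAction.trivial _, ⟨fun _ _ => rfl, fun _ _ h => h⟩,
    hsplit.cofull (crossModule.cofull hE), κ', fun _ _ => rfl, fun x => ?_⟩
  have hmap : Crossed.mapEquiv κ hκ ((descHom e).toHom x) = Crossed.map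
      (cornerHom B.quadratik E I i) (cornerHom_equivariant B.quadratik S U hU) x :=
    Crossed.map_map e.equivariant hκ _ hκe x
  refine hsplit.compacts_ext fun z => (hsplit.compactsMap_apply _ z).trans ?_
  refine Eq.trans ?_ (map_crossRep_cornerHom B.quadratik S hU coord_crossSplitCoord_single
    crossSplitCoord_single_single x z)
  rw [← hmap]
  rfl

end IsCorner

/-! ### The descent functor -/

section homotopy

variable {B : Type u} [NonUnitalRing B] {α : G →* RingAut A} {β : G →* RingAut B}

variable (β) in
/-- The map `b ⊗ c ↦ (b ⋊ g) ⊗ c`. -/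
def crossTensor (g : G) :
    B ⊗[ℤ] C(unitInterval, ℂ) →ₗ[ℤ] Crossed β ⊗[ℤ] C(unitInterval, ℂ) :=
  (Crossed.mkHom β g).toIntLinearMap.rTensor _

theorem crossTensor_mul_crossTensor (g h : G) (u v : B ⊗[ℤ] C(unitInterval, ℂ)) :
    crossTensor β g u * crossTensor β h v = crossTensor β (g * h)
      (u * TensorProduct.map (AddMonoidHom.toIntLinearMap (β g : B ≃+ B).toAddMonoidHom)
        LinearMap.id v) := by
  have hbilin : Algebra.TensorProduct.mul.compl₁₂ (crossTensor β g) (crossTensor β h) =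
      (Algebra.TensorProduct.mul.compl₂ (TensorProduct.map
        (AddMonoidHom.toIntLinearMap (β g : B ≃+ B).toAddMonoidHom) LinearMap.id)).compr₂
          (crossTensor β (g * h)) :=
    TensorProduct.ext' fun b c => TensorProduct.ext' fun b' c' => by
      change (Crossed.mk β b g ⊗ₜ[ℤ] c) * (Crossed.mk β b' h ⊗ₜ[ℤ] c') =
        crossTensor β (g * h) ((b ⊗ₜ[ℤ] c) * (β g b' ⊗ₜ[ℤ] c'))
      rw [Algebra.TensorProduct.tmul_mul_tmul, Algebra.TensorProduct.tmul_mul_tmul,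
        Crossed.mk_mul_mk]
      rfl
  exact DFunLike.congr_fun (DFunLike.congr_fun hbilin u) v

theorem evalAt_crossTensor (t : unitInterval) (g : G) (u : B ⊗[ℤ] C(unitInterval, ℂ)) :
    evalAt (Crossed β) t (crossTensor β g u) =
      (Crossed.mkHom β g).toIntLinearMap.rTensor ℂ (evalAt B t u) := by
  induction u using TensorProduct.induction_on with
  | zero => simp only [map_zero]
  | add u u' hu hu' => simp only [map_add, hu, hu']
  | tmul b c => rfl

variable {f : A →ₙ+* B ⊗[ℤ] C(unitInterval, ℂ)}

/-- The homotopy `a ⋊ g ↦ f(a) ⋊ g` of crossed products induced by an equivariant homotopy `f`. -/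
def crossHomotopy (hf : ∀ g a, f (α g a) = TensorProduct.map
      (AddMonoidHom.toIntLinearMap (β g : B ≃+ B).toAddMonoidHom) LinearMap.id (f a)) :
    Crossed α →ₙ+* Crossed β ⊗[ℤ] C(unitInterval, ℂ) where
  __ := Crossed.lift α fun g => (crossTensor β g).toAddMonoidHom.comp f.toAddMonoidHom
  map_mul' := by
    refine Crossed.map_mul_of_mk (R := Crossed β ⊗[ℤ] C(unitInterval, ℂ)) (Crossed.lift α
      fun g => (crossTensor β g).toAddMonoidHom.comp f.toAddMonoidHom) fun a b g k => ?_
    rw [Crossed.mk_mul_mk, Crossed.lift_mk, Crossed.lift_mk, Crossed.lift_mk]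
    change crossTensor β (g * k) (f (a * α g b)) = crossTensor β g (f a) * crossTensor β k (f b)
    rw [crossTensor_mul_crossTensor, map_mul, hf]

theorem crossHomotopy_mk (hf : ∀ g a, f (α g a) = TensorProduct.map
      (AddMonoidHom.toIntLinearMap (β g : B ≃+ B).toAddMonoidHom) LinearMap.id (f a))
    (a : A) (g : G) : crossHomotopy hf (Crossed.mk α a g) = crossTensor β g (f a) :=
  Crossed.lift_mk α (fun g => (crossTensor β g).toAddMonoidHom.comp f.toAddMonoidHom) a g

theorem evalAt_crossHomotopy (hf : ∀ g a, f (α g a) = TensorProduct.map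
      (AddMonoidHom.toIntLinearMap (β g : B ≃+ B).toAddMonoidHom) LinearMap.id (f a))
    {π : A →ₙ+* B} (hπ : ∀ g a, π (α g a) = β g (π a)) {t : unitInterval}
    (ht : ∀ a, evalAt B t (f a) = π a ⊗ₜ[ℤ] (1 : ℂ)) (x : Crossed α) :
    evalAt (Crossed β) t (crossHomotopy hf x) = Crossed.map π hπ x ⊗ₜ[ℤ] (1 : ℂ) := by
  induction x using Crossed.induction with
  | h0 => rw [map_zero, map_zero, map_zero, TensorProduct.zero_tmul]
  | hadd x y hx hy => rw [map_add, map_add, map_add, TensorProduct.add_tmul, hx, hy]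
  | hmk a g => rw [crossHomotopy_mk, evalAt_crossTensor, ht, Crossed.map_mk]; rfl

theorem homotopic_descHom {A B : QRing G} {f₀ f₁ : EHom A B} (h : Homotopic f₀ f₁) :
    Homotopic (descHom f₀) (descHom f₁) := by
  obtain ⟨_, hf, h₀, h₁⟩ := h
  exact ⟨crossHomotopy hf, fun _ _ => (DFunLike.congr_fun TensorProduct.map_id _).symm,
    evalAt_crossHomotopy hf f₀.equivariant h₀, evalAt_crossHomotopy hf f₁.equivariant h₁⟩

end homotopy

section descentFunctor

theorem descHom_comp {A B C : QRing G} (f : EHom A B) (h : EHom B C) :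
    (descHom f).comp (descHom h) = descHom (f.comp h) :=
  EHom.ext <| NonUnitalRingHom.ext <|
    Crossed.map_map f.equivariant h.equivariant (f.comp h).equivariant fun _ => rfl

theorem descHom_id (A : QRing G) : descHom (EHom.id A) = EHom.id (descObj A) :=
  EHom.ext <| NonUnitalRingHom.ext fun x => Crossed.ext fun g =>
    Crossed.coeff_map (EHom.id A).toHom (EHom.id A).equivariant x g

theorem descHom_mul_descHom_eq_zero {A B C : QRing G} {i : EHom A C} {k : EHom B C}
    (h : ∀ a b, i.toHom a * k.toHom b = 0) (x : descObj A) (y : descObj B) :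
    (descHom i).toHom x * (descHom k).toHom y = 0 := by
  refine Crossed.mem_of_mk_mem (K := ((AddMonoidHom.mulRight ((descHom k).toHom y)).comp
    (descHom i).toHom.toAddMonoidHom).ker) (fun a g => ?_) x
  refine Crossed.mem_of_mk_mem (K := ((AddMonoidHom.mulLeft
    ((descHom i).toHom (Crossed.mk A.action a g))).comp
      (descHom k).toHom.toAddMonoidHom).ker) (fun b l => ?_) y
  change Crossed.map i.toHom i.equivariant _ * Crossed.map k.toHom k.equivariant _ = 0
  rw [Crossed.map_mk, Crossed.map_mk, Crossed.mk_mul_mk, ← k.equivariant, h]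
  exact map_zero (Crossed.mkHom C.action (g * l))

/-- The homomorphism `C → A × B` with components `p` and `q`. -/
def EHom.pair {A B C : QRing G} (p : EHom C A) (q : EHom C B) : EHom C (A.prod B) where
  toHom := p.toHom.prod q.toHom
  equivariant g c := Prod.ext (p.equivariant g c) (q.equivariant g c)

/-- The homomorphism `(a, b) ↦ i(a) + k(b)` defined by homomorphisms with orthogonal ranges. -/
def EHom.copair {A B C : QRing G} (i : EHom A C) (k : EHom B C)
    (hik : ∀ a b, i.toHom a * k.toHom b = 0) (hki : ∀ b a, k.toHom b * i.toHom a = 0) :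
    EHom (A.prod B) C where
  toHom :=
    { __ := AddMonoidHom.coprod i.toHom.toAddMonoidHom k.toHom.toAddMonoidHom
      map_mul' := fun ⟨a, b⟩ ⟨a', b'⟩ => by
        change i.toHom (a * a') + k.toHom (b * b') =
          (i.toHom a + k.toHom b) * (i.toHom a' + k.toHom b')
        rw [add_mul, mul_add, mul_add, hik, hki, add_zero, zero_add, map_mul, map_mul] }
  equivariant g := fun ⟨a, b⟩ => by
    change i.toHom (A.action g a) + k.toHom (B.action g b) =
      C.action g (i.toHom a + k.toHom b)
    rw [i.equivariant, k.equivariant, map_add]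

namespace GK

theorem ofHom_id (A : QRing G) : ofHom (EHom.id A) = 𝟙 (⟨A⟩ : GK G) :=
  Quotient.sound (Rel.hom_id A)

theorem ofHom_comp {A B C : QRing G} (f : EHom A B) (h : EHom B C) :
    ofHom f ≫ ofHom h = ofHom (f.comp h) :=
  Quotient.sound (Rel.hom_comp f h)

theorem ofHom_biprod (A B : QRing G) :
    𝟙 (⟨A.prod B⟩ : GK G) = ofHom (EHom.fst A B) ≫ ofHom (EHom.inl A B) +
      ofHom (EHom.snd A B) ≫ ofHom (EHom.inr A B) :=
  Quotient.sound (Rel.biprod A B)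

theorem ofHom_cornerInv {A K : QRing G} {e : EHom A K} (he : IsCorner e) :
    ofHom e ≫ cornerInv e he = 𝟙 (⟨A⟩ : GK G) :=
  Quotient.sound (Rel.corner_left e he)

theorem cornerInv_ofHom {A K : QRing G} {e : EHom A K} (he : IsCorner e) :
    cornerInv e he ≫ ofHom e = 𝟙 (⟨K⟩ : GK G) :=
  Quotient.sound (Rel.corner_right e he)

theorem isIso_ofHom {A K : QRing G} {e : EHom A K} (he : IsCorner e) : IsIso (ofHom e) :=
  ⟨cornerInv e he, ofHom_cornerInv he, cornerInv_ofHom he⟩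

theorem ofHom_delta (s : SplitExact G) : ofHom s.j ≫ delta s = 𝟙 (⟨s.B⟩ : GK G) :=
  Quotient.sound (Rel.split_left s)

theorem delta_ofHom_add (s : SplitExact G) :
    delta s ≫ ofHom s.j + ofHom s.f ≫ ofHom s.s = 𝟙 (⟨s.M⟩ : GK G) :=
  Quotient.sound (Rel.split_right s)

theorem id_eq_comp_add_comp {A B C : QRing G} {p : EHom C A} {q : EHom C B} {i : EHom A C}
    {k : EHom B C} (hik : ∀ a b, i.toHom a * k.toHom b = 0)
    (hki : ∀ b a, k.toHom b * i.toHom a = 0)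
    (h : ∀ c, i.toHom (p.toHom c) + k.toHom (q.toHom c) = c) :
    𝟙 (⟨C⟩ : GK G) = ofHom p ≫ ofHom i + ofHom q ≫ ofHom k := by
  let r := EHom.copair i k hik hki
  have hr : (p.pair q).comp r = EHom.id C := EHom.ext (NonUnitalRingHom.ext h)
  have hi : (EHom.inl A B).comp r = i := EHom.ext (NonUnitalRingHom.ext fun a =>
    (congrArg (i.toHom a + ·) (map_zero k.toHom)).trans (add_zero _))
  have hk : (EHom.inr A B).comp r = k := EHom.ext (NonUnitalRingHom.ext fun b =>
    (congrArg (· + k.toHom b) (map_zero i.toHom)).trans (zero_add _))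
  have hp : ofHom (p.pair q) ≫ ofHom (EHom.fst A B) = ofHom p := ofHom_comp _ _
  have hq : ofHom (p.pair q) ≫ ofHom (EHom.snd A B) = ofHom q := ofHom_comp _ _
  calc 𝟙 (⟨C⟩ : GK G) = ofHom (p.pair q) ≫ 𝟙 _ ≫ ofHom r := by
        rw [Category.id_comp, ofHom_comp, hr, ofHom_id]
    _ = (ofHom (p.pair q) ≫ ofHom (EHom.fst A B)) ≫ ofHom (EHom.inl A B) ≫ ofHom r +
        (ofHom (p.pair q) ≫ ofHom (EHom.snd A B)) ≫ ofHom (EHom.inr A B) ≫ ofHom r := by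
      simp only [ofHom_biprod, Preadditive.add_comp, Preadditive.comp_add, Category.assoc]
    _ = ofHom p ≫ ofHom i + ofHom q ≫ ofHom k := by
      rw [hp, hq, ofHom_comp (EHom.inl A B), ofHom_comp (EHom.inr A B), hi, hk]

theorem ofHom_descHom_biprod (A B : QRing G) : 𝟙 (⟨descObj (A.prod B)⟩ : GK PUnit.{u + 1}) =
    ofHom (descHom (EHom.fst A B)) ≫ ofHom (descHom (EHom.inl A B)) +
      ofHom (descHom (EHom.snd A B)) ≫ ofHom (descHom (EHom.inr A B)) := by
  refine id_eq_comp_add_comp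
    (descHom_mul_descHom_eq_zero fun a b => Prod.ext (mul_zero a) (zero_mul b))
    (descHom_mul_descHom_eq_zero fun b a => Prod.ext (zero_mul a) (mul_zero b))
    fun (c : Crossed (A.prod B).action) => Crossed.ext fun g => ?_
  change Crossed.coeff (Crossed.map (EHom.inl A B).toHom (EHom.inl A B).equivariant
      (Crossed.map (EHom.fst A B).toHom (EHom.fst A B).equivariant c)) g +
    Crossed.coeff (Crossed.map (EHom.inr A B).toHom (EHom.inr A B).equivariant
      (Crossed.map (EHom.snd A B).toHom (EHom.snd A B).equivariant c)) g = Crossed.coeff c g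
  rw [Crossed.coeff_map, Crossed.coeff_map, Crossed.coeff_map, Crossed.coeff_map]
  exact Prod.ext (add_zero _) (zero_add _)

theorem induction {P : ∀ ⦃X Y : GK G⦄, (X ⟶ Y) → Prop}
    (hom : ∀ {A B : QRing G} (f : EHom A B), P (ofHom f))
    (corner : ∀ {A K : QRing G} {e : EHom A K} (he : IsCorner e), P (cornerInv e he))
    (split : ∀ s : SplitExact G, P (delta s))
    (comp : ∀ {X Y Z : GK G} (f : X ⟶ Y) (h : Y ⟶ Z), P f → P h → P (f ≫ h))
    (zero : ∀ X Y : GK G, P (0 : X ⟶ Y))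
    (add : ∀ {X Y : GK G} (f h : X ⟶ Y), P f → P h → P (f + h))
    (neg : ∀ {X Y : GK G} (f : X ⟶ Y), P f → P (-f)) {X Y : GK G} (f : X ⟶ Y) : P f := by
  have hcls : ∀ {A B : QRing G} (x : Word G A B), P (cls x : (⟨A⟩ : GK G) ⟶ ⟨B⟩) := by
    intro A B x
    induction x with
    | hom f => exact hom f
    | cornerInv e he => exact corner he
    | delta s => exact split s
    | one A => exact (ofHom_id A ▸ hom (EHom.id A) : P (𝟙 (⟨A⟩ : GK G)))
    | comp x y hx hy => exact comp _ _ hx hy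
    | zero A B => exact zero _ _
    | add x y hx hy => exact add _ _ hx hy
    | neg x hx => exact neg _ hx
  obtain ⟨x⟩ := f
  exact hcls x

theorem naturality_of_ofHom {C : Type*} [Category C] [Preadditive C] {F F' : GK G ⥤ C}
    [F.Additive] [F'.Additive] {η : ∀ X, F.obj X ⟶ F'.obj X}
    (h : ∀ {A B : QRing G} (π : EHom A B), F.map (ofHom π) ≫ η _ = η _ ≫ F'.map (ofHom π))
    {X Y : GK G} (f : X ⟶ Y) : F.map f ≫ η Y = η X ≫ F'.map f := by
  induction f using GK.induction with
  | hom π => exact h π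
  | @corner A K e he =>
    have := isIso_ofHom he
    rw [← cancel_mono (F'.map (ofHom e)), Category.assoc, Category.assoc, ← F'.map_comp,
      cornerInv_ofHom, ← h, ← Category.assoc, ← F.map_comp, cornerInv_ofHom, F.map_id, F'.map_id,
      Category.id_comp, Category.comp_id]
  | split s =>
    have hproj : F.map (delta s ≫ ofHom s.j) ≫ η _ = η _ ≫ F'.map (delta s ≫ ofHom s.j) := by
      rw [eq_sub_of_add_eq (delta_ofHom_add s), F.map_sub, F'.map_sub, Preadditive.sub_comp,
        Preadditive.comp_sub, F.map_comp, F'.map_comp, Category.assoc, h, reassoc_of% h s.f,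
        F.map_id, F'.map_id, Category.id_comp, Category.comp_id]
    calc F.map (delta s) ≫ η _ = F.map (delta s) ≫ η _ ≫ F'.map (ofHom s.j ≫ delta s) := by
          rw [ofHom_delta, F'.map_id, Category.comp_id]
      _ = F.map (delta s ≫ ofHom s.j) ≫ η _ ≫ F'.map (delta s) := by
        rw [F'.map_comp, ← reassoc_of% h s.j, F.map_comp, Category.assoc]
      _ = η _ ≫ F'.map (delta s ≫ ofHom s.j ≫ delta s) := by
        rw [reassoc_of% hproj, ← F'.map_comp, Category.assoc]
      _ = η _ ≫ F'.map (delta s) := by rw [ofHom_delta, Category.comp_id]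
  | comp f h hf hh => rw [F.map_comp, F'.map_comp, Category.assoc, hh, reassoc_of% hf]
  | zero X Y => rw [F.map_zero, F'.map_zero, Limits.zero_comp, Limits.comp_zero]
  | add f h hf hh =>
    rw [F.map_add, F'.map_add, Preadditive.add_comp, Preadditive.comp_add, hf, hh]
  | neg f hf => rw [F.map_neg, F'.map_neg, Preadditive.neg_comp, Preadditive.comp_neg, hf]

end GK

/-- The value of the descent functor on words. -/
def descWord : {A B : QRing G} → Word G A B → Word PUnit.{u + 1} (descObj A) (descObj B)
  | _, _, .hom f => .hom (descHom f)
  | _, _, .cornerInv e he => .cornerInv (descHom e) (isCorner_descHom he)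
  | _, _, .delta s => .delta (descSplit s)
  | _, _, .one A => .one (descObj A)
  | _, _, .comp x y => .comp (descWord x) (descWord y)
  | _, _, .zero A B => .zero (descObj A) (descObj B)
  | _, _, .add x y => .add (descWord x) (descWord y)
  | _, _, .neg x => .neg (descWord x)

theorem rel_descWord {A B : QRing G} {x y : Word G A B} (h : Rel x y) :
    Rel (descWord x) (descWord y) := by
  induction h with
  | refl x => exact Rel.refl _
  | symm _ ih => exact ih.symm
  | trans _ _ ih ih' => exact ih.trans ih'
  | comp_congr _ _ ih ih' => exact Rel.comp_congr ih ih'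
  | add_congr _ _ ih ih' => exact Rel.add_congr ih ih'
  | neg_congr _ ih => exact Rel.neg_congr ih
  | comp_assoc x y z => exact Rel.comp_assoc _ _ _
  | one_comp x => exact Rel.one_comp _
  | comp_one x => exact Rel.comp_one _
  | add_assoc x y z => exact Rel.add_assoc _ _ _
  | add_comm x y => exact Rel.add_comm _ _
  | zero_add x => exact Rel.zero_add _
  | neg_add x => exact Rel.neg_add _
  | comp_add x y z => exact Rel.comp_add _ _ _
  | add_comp x y z => exact Rel.add_comp _ _ _
  | hom_comp f h =>
    change Rel _ (Word.hom (descHom (f.comp h)))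
    exact descHom_comp f h ▸ Rel.hom_comp (descHom f) (descHom h)
  | hom_id A =>
    change Rel (Word.hom (descHom (EHom.id A))) _
    exact descHom_id A ▸ Rel.hom_id (descObj A)
  | biprod A B => exact Quotient.exact (GK.ofHom_descHom_biprod A B)
  | homotopy f₀ f₁ h => exact Rel.homotopy _ _ (homotopic_descHom h)
  | corner_left e he => exact Rel.corner_left _ _
  | corner_right e he => exact Rel.corner_right _ _
  | split_left s => exact Rel.split_left (descSplit s)
  | split_right s => exact Rel.split_right (descSplit s)

variable (G) in
/-- The descent functor `j^G`. -/
def descentFunctor : GK G ⥤ GK PUnit.{u + 1} where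
  obj A := ⟨descObj A.ring⟩
  map {A B} x := Quotient.map descWord (fun _ _ h => rel_descWord h) x
  map_id _ := rfl
  map_comp := by rintro A B C ⟨x⟩ ⟨y⟩; rfl

theorem eq_id_comp_comp_id {A B : GK G} (x : A ⟶ B) : x = 𝟙 A ≫ x ≫ 𝟙 B := by
  rw [Category.id_comp, Category.comp_id]

theorem isDescentFunctor_descentFunctor : IsDescentFunctor (descentFunctor G) where
  additive := ⟨by rintro A B ⟨x⟩ ⟨y⟩; rfl⟩
  obj_eq _ := rfl
  map_ofHom π := eq_id_comp_comp_id (GK.ofHom (descHom π))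
  map_cornerInv _ he := by
    have hiso := GK.isIso_ofHom (isCorner_descHom he)
    exact ⟨hiso, (IsIso.inv_eq_of_hom_inv_id (GK.ofHom_cornerInv (isCorner_descHom he))).symm.trans
      (eq_id_comp_comp_id _)⟩
  map_delta s := eq_id_comp_comp_id (GK.delta (descSplit s))

theorem IsDescentFunctor.eq {F F' : GK G ⥤ GK PUnit.{u + 1}} (hF : IsDescentFunctor F)
    (hF' : IsDescentFunctor F') : F = F' := by
  have := hF.additive
  have := hF'.additive
  have hobj : ∀ X, F.obj X = F'.obj X := fun X =>
    (hF.obj_eq X.ring).trans (hF'.obj_eq X.ring).symm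
  refine CategoryTheory.Functor.ext hobj fun X Y f => ?_
  have hnat := GK.naturality_of_ofHom (F := F) (F' := F') (η := fun X => eqToHom (hobj X))
    (fun π => by
      rw [hF.map_ofHom, hF'.map_ofHom]
      simp only [Category.assoc, eqToHom_trans, eqToHom_trans_assoc]) f
  rw [← reassoc_of% hnat, eqToHom_trans, eqToHom_refl, Category.comp_id]

theorem existsUnique_isDescentFunctor : ∃! F : GK G ⥤ GK PUnit.{u + 1}, IsDescentFunctor F :=
  ⟨descentFunctor G, isDescentFunctor_descentFunctor,
    fun _ hF => hF.eq isDescentFunctor_descentFunctor⟩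

end descentFunctor

end

end GKT

theorem mainTheorem7 {G : Type u} [Group G] :
    -- the isomorphism `σ : K_B(E) ⋊ G ≅ K_{B ⋊ G}(E ⊗_B (B ⋊ G))`
    (∀ (B : QRing G) (E : FModule B) (S : ModAction B.action E), E.Cofull →
      (descentModule B.action E).Cofull ∧
      ∃ σ : Crossed S.Ad →ₙ+* (descentModule B.action E).compacts,
        IsDescentIso S σ ∧
        Function.Surjective σ ∧
        (∀ x : Crossed S.Ad, σ x = 0 ↔
          ∀ g ξ, ∀ φ ∈ E.functionals, φ ((Crossed.coeff x g).1 ξ) = 0) ∧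
        (E.Separated → Function.Bijective σ)) ∧
    -- the commuting diagram for a corner embedding `e : B → K_B(E ⊕ H_B)`
    (∀ (B : QRing G) (E : FModule B) (S : ModAction B.action E) (I : Type u) (i₀ : I)
      (U : ModAction B.action (FModule.copies B I)) (hU : U.IsDistinguished i₀),
      (E.prod (FModule.copies B I)).Cofull → (E.prod (FModule.copies B I)).Separated →
      ((descentModule B.action E).prod (FModule.copies (Crossed B.action) I)).Cofull ∧
      ∃ (σ : Crossed (S.prod U).Ad ≃+*
            (descentModule B.action (E.prod (FModule.copies B I))).compacts)
        (X : descentModule B.action (E.prod (FModule.copies B I)) ≃+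
            (descentModule B.action E).prod (FModule.copies (Crossed B.action) I))
        (π : (descentModule B.action (E.prod (FModule.copies B I))).compacts →ₙ+*
            ((descentModule B.action E).prod (FModule.copies (Crossed B.action) I)).compacts),
        IsDescentIso (S.prod U) σ ∧
        (∀ (ξ : E) (η : FModule.copies B I) (x : Crossed B.action),
          (X (descentTmul B.action (E.prod (FModule.copies B I)) (ξ, η) x)).1 =
            descentTmul B.action E ξ x ∧
          ∀ i, FModule.coord i
            (X (descentTmul B.action (E.prod (FModule.copies B I)) (ξ, η) x)).2 =
              Crossed.mk B.action (FModule.coord i η) 1 * x) ∧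
        (∀ T z, (π T : AddMonoid.End _) (X z) = X ((T : AddMonoid.End _) z)) ∧
        Function.Injective π ∧
        (Finite I → Function.Bijective π) ∧
        (∀ x : Crossed B.action,
          π (σ (Crossed.map (cornerHom B.quadratik E I i₀)
              (cornerHom_equivariant B.quadratik S U hU) x)) =
            cornerHom (Crossed.quadratik B.action B.quadratik)
              (descentModule B.action E) I i₀ x) ∧
        (Function.Injective (cornerHom B.quadratik E I i₀) →
          Function.Injective (cornerHom (Crossed.quadratik B.action B.quadratik)
            (descentModule B.action E) I i₀))) ∧
    -- descent maps corner embeddings to corner embeddings (up to isomorphism)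
    (∀ (A K : QRing G) (e : EHom A K), IsCorner e → IsCorner (descHom e)) ∧
    -- the descent functor is well-defined
    (∃! F : GK G ⥤ GK PUnit.{u + 1}, IsDescentFunctor F) := by
  refine ⟨fun B E S hE => ?_, fun B E S I i₀ U hU hcofull hsep => ?_,
    fun _ _ _ => isCorner_descHom, existsUnique_isDescentFunctor⟩
  · have hE' := hE.nondegenerate
    exact ⟨cofull_descentModule hE, descentMap S hE', isDescentIso_descentMap hE',
      descentMap_surjective hE', descentMap_eq_zero_iff hE', descentMap_bijective hE'⟩
  · have hnondeg := hcofull.nondegenerate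
    have hX := isCovering_descentProdEquiv (α := B.action) hnondeg hsep
    have hinj := hX.compactsMap_injective (descentProdEquiv B.action hnondeg hsep).injective
    exact ⟨(isCovering_crossToDescentProd hnondeg).cofull (crossModule.cofull hcofull),
      RingEquiv.ofBijective _ (descentMap_bijective (S := S.prod U) hnondeg hsep),
      descentProdEquiv B.action hnondeg hsep, hX.compactsMap, isDescentIso_descentMap hnondeg,
      fun ξ η x => ⟨descentProdEquiv_tmul_fst hnondeg hsep (ξ, η) x,
        coord_descentProdEquiv_tmul hnondeg hsep (ξ, η) x⟩,
      hX.compactsMap_apply, hinj,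
      fun _ => ⟨hinj,
        (isQuotient_descentProdEquiv hnondeg hsep B.quadratik).compactsMap_surjective⟩,
      compactsMap_descentMap_cornerHom hnondeg hsep B.quadratik S hU,
      cornerHom_crossed_injective B.quadratik i₀⟩
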